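/- Let $n$ be a natural number, let $G\subset S_n$ be a subgroup, acting on $K=[0,1]^n$ by $(\sigma\cdot x)_i=x_{\sigma^{-1}(i)}$, and let $\alpha>0$, $B>0$. Let $\mathcal C^\alpha_B$ be the set of continuous functions $f\colon K\to\mathbb R$ all of whose partial derivatives up to order $\lfloor\alpha\rfloor$ exist on $K$ (one-sided at the boundary) and for which $$\max_{|\beta|<\lfloor\alpha\rfloor}\ \sup_{x\in K}|\partial^\beta f(x)|+\max_{|\beta|=\lfloor\alpha\rfloor}\ \sup_{x\ne x'\in K}\frac{|\partial^\beta f(x)-\partial^\beta f(x')|}{\|x-x'\|_\infty^{\alpha-\lfloor\alpha\rfloor}}\le B,$$ where a maximum over the empty set is $0$ and $\partial^\beta$ runs over iterated partial derivatives taken in any order. A ReLU network from $K$ to $\mathbb R$ is a finite composition of affine layers, all but the last followed by a coordinatewise ReLU $t\mapsto\max(t,0)$; its number of nonzero parameters is the number of nonzero weights and biases, and it is called $G$-invariant if the function on $K$ which it computes is $G$-invariant. Then there are functions $L,P\colon(0,\infty)\to\mathbb N$, depending only on $n,G,\alpha,B$, with $$L(\varepsilon)=O(\log(1/\varepsilon)),\qquad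 P(\varepsilon)=O\bigl(\varepsilon^{-n/\alpha}\log(1/\varepsilon)\bigr)\qquad(\varepsilon\to0^+),$$ such that for every $\varepsilon>0$ and every $G$-invariant $F\in\mathcal C^\alpha_B$ there is a $G$-invariant ReLU network $\widehat F$ with at most $L(\varepsilon)$ layers and at most $P(\varepsilon)$ nonzero parameters such that $$\sup_{x\in K}|\widehat F(x)-F(x)|\le\varepsilon .$$ -/

import Mathlib

open Filter Topology

/-- The unit cube `[0,1]^n`. -/
def unitCube (n : ℕ) : Set (Fin n → ℝ) := {x | ∀ i, x i ∈ Set.Icc (0 : ℝ) 1}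

/-- The left action of a permutation on coordinates, `(σ • x) i = x (σ⁻¹ i)`. -/
def permuteCoords {n : ℕ} (σ : Equiv.Perm (Fin n)) (x : Fin n → ℝ) : Fin n → ℝ :=
  fun i => x (σ⁻¹ i)

/-- Invariance of a real function on the unit cube under a group of coordinate permutations. -/
def IsInvariantOnCube {n : ℕ} (G : Subgroup (Equiv.Perm (Fin n))) (f : (Fin n → ℝ) → ℝ) : Prop :=
  ∀ σ ∈ G, ∀ x ∈ unitCube n, f (permuteCoords σ x) = f x

/-! ### Hölder balls on the unit cube -/

/-- The partial derivative in direction `i` of a function on the unit cube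
(one-sided at the faces of the cube). -/
noncomputable def cubePartial {n : ℕ} (i : Fin n) (f : (Fin n → ℝ) → ℝ) : (Fin n → ℝ) → ℝ :=
  fun x => derivWithin (fun t : ℝ => f (Function.update x i t)) (Set.Icc 0 1) (x i)

/-- The iterated partial derivative along a list of coordinate directions; its order is the length
of the list, and the last entry of the list is differentiated first. -/
noncomputable def cubeIterPartial {n : ℕ} : List (Fin n) → ((Fin n → ℝ) → ℝ) → ((Fin n → ℝ) → ℝ)
  | [], f => f
  | i :: l, f => cubePartial i (cubeIterPartial l f)

/-- All partial derivatives up to order `m` exist at every point of the unit cube. -/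
def HasCubePartials {n : ℕ} (m : ℕ) (f : (Fin n → ℝ) → ℝ) : Prop :=
  ∀ l : List (Fin n), l.length < m → ∀ i : Fin n, ∀ x ∈ unitCube n,
    DifferentiableWithinAt ℝ (fun t : ℝ => cubeIterPartial l f (Function.update x i t))
      (Set.Icc 0 1) (x i)

/-- The Hölder norm of order `α` on the unit cube, with values in `[0, ∞]`: the largest supremum of
a partial derivative of order less than `⌊α⌋`, plus the largest `(α - ⌊α⌋)`-Hölder seminorm of a
partial derivative of order `⌊α⌋`. The norm on `Fin n → ℝ` is the supremum norm. -/
noncomputable def holderNorm {n : ℕ} (α : ℝ) (f : (Fin n → ℝ) → ℝ) : ENNReal :=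
  (⨆ (l : List (Fin n)) (_ : l.length < ⌊α⌋₊) (x ∈ unitCube n),
      ENNReal.ofReal |cubeIterPartial l f x|) +
  ⨆ (l : List (Fin n)) (_ : l.length = ⌊α⌋₊) (x ∈ unitCube n) (x' ∈ unitCube n) (_ : x ≠ x'),
      ENNReal.ofReal
        (|cubeIterPartial l f x - cubeIterPartial l f x'| / ‖x - x'‖ ^ (α - (⌊α⌋₊ : ℝ)))

/-- The ball of radius `B` of the Hölder space of order `α` on the unit cube. Only the values on
the cube matter. -/
def holderBall (n : ℕ) (α B : ℝ) : Set ((Fin n → ℝ) → ℝ) :=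
  {f | ContinuousOn f (unitCube n) ∧ HasCubePartials ⌊α⌋₊ f ∧ holderNorm α f ≤ ENNReal.ofReal B}

/-! ### ReLU networks -/

/-- Feed-forward networks with output dimension `k`, indexed by the input dimension: finitely many
hidden layers of arbitrary widths, followed by an affine output layer. -/
inductive ReLUNet (k : ℕ) : ℕ → Type
  | output {d : ℕ} (W : Matrix (Fin k) (Fin d) ℝ) (b : Fin k → ℝ) : ReLUNet k d
  | hidden {d h : ℕ} (W : Matrix (Fin h) (Fin d) ℝ) (b : Fin h → ℝ) (rest : ReLUNet k h) :
      ReLUNet k d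

namespace ReLUNet

/-- The function computed by a network: hidden layers compute `x ↦ max (W x + b) 0` entrywise, the
output layer computes `x ↦ W x + b`. -/
noncomputable def eval {k : ℕ} : {d : ℕ} → ReLUNet k d → (Fin d → ℝ) → (Fin k → ℝ)
  | _, output W b, x => W.mulVec x + b
  | _, hidden W b rest, x => rest.eval (fun j => max ((W.mulVec x + b) j) 0)

/-- The number of layers (hidden layers and the output layer). -/
def numLayers {k : ℕ} : {d : ℕ} → ReLUNet k d → ℕ
  | _, output _ _ => 1
  | _, hidden _ _ rest => rest.numLayers + 1

/-- The number of nonzero weights and biases of one affine layer. -/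
noncomputable def affineNonzeros {h d : ℕ} (W : Matrix (Fin h) (Fin d) ℝ) (b : Fin h → ℝ) : ℕ :=
  (Finset.univ.filter fun p : Fin h × Fin d => W p.1 p.2 ≠ 0).card +
    (Finset.univ.filter fun j : Fin h => b j ≠ 0).card

/-- The number of nonzero parameters (weights and biases) of a network. -/
noncomputable def numNonzeroParams {k : ℕ} : {d : ℕ} → ReLUNet k d → ℕ
  | _, output W b => affineNonzeros W b
  | _, hidden W b rest => affineNonzeros W b + rest.numNonzeroParams

end ReLUNet

/-- The class of ReLU networks from the unit cube to `ℝ` that compute a `G`-invariant function,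
with at most `L` layers and at most `P` nonzero parameters. -/
def invariantReLUNets {n : ℕ} (G : Subgroup (Equiv.Perm (Fin n))) (L P : ℕ) : Set (ReLUNet 1 n) :=
  {N | N.numLayers ≤ L ∧ N.numNonzeroParams ≤ P ∧ IsInvariantOnCube G (fun x => N.eval x 0)}

/-! ### Hidden states of networks -/

/-! A function in the Hölder ball is within `O(N ^ (-α))` of a sum of Taylor polynomials at the
points of a grid of mesh `1 / N`, glued by products of hat functions. With `N` of order `ε ^ (-1 /
α)` there are `(N + 1) ^ n = O(ε ^ (-n / α))` terms, and each is built from hats and coordinates by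
a number of sums and products that does not depend on `ε`.

A ReLU network multiplies approximately: the tent map expands `t - t ^ 2` into a geometrically
convergent series of its iterates, so precision `2⁻ʳ` takes `O(r)` layers and parameters, and
polarisation turns squares into products (`IsNeuron.exists_mul`). The predicate `LogApprox C`
packages this cost; it is stable under sums and products, with constants independent of `N` and of
the function. Taking `r` of order `log (1 / ε)` absorbs the accumulated error of all the terms.

Invariance comes from averaging over `G` (`exists_net_average`). Permuting the inputs of a network
only permutes its first weights, so the average costs a factor `|G|`, is exactly invariant, and
keeps the error because the target is itself invariant (`exists_invariant_net`). -/

/-- A hidden layer with arbitrary index types. -/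
def reluLayer {ι κ : Type} [Fintype κ] (W : ι → κ → ℝ) (b : ι → ℝ) (v : κ → ℝ) : ι → ℝ :=
  fun i => max (∑ j, W i j * v j + b i) 0

/-- The number of nonzero weights and biases of a layer with arbitrary index types. -/
noncomputable def layerCost {ι κ : Type} [Fintype ι] [Fintype κ] (W : ι → κ → ℝ) (b : ι → ℝ) : ℕ :=
  (∑ i, ∑ j, if W i j ≠ 0 then 1 else 0) + ∑ i, if b i ≠ 0 then 1 else 0

/-- `S` is the vector of activations after `L + 1` hidden layers having at most `P` nonzero
parameters in total. -/
def IsHiddenState {n : ℕ} :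
    ℕ → ℕ → ∀ {ι : Type} [Fintype ι], ((Fin n → ℝ) → ι → ℝ) → Prop
  | 0, P, ι, _, S => ∃ (W : ι → Fin n → ℝ) (b : ι → ℝ), layerCost W b ≤ P ∧
      S = fun x => reluLayer W b x
  | L + 1, P, ι, _, S => ∃ (κ : Type) (_ : Fintype κ) (Q : ℕ) (T : (Fin n → ℝ) → κ → ℝ),
      IsHiddenState L Q T ∧ ∃ (W : ι → κ → ℝ) (b : ι → ℝ), Q + layerCost W b ≤ P ∧
        S = fun x => reluLayer W b (T x)

theorem layerCost_le {ι κ : Type} [Fintype ι] [Fintype κ] (W : ι → κ → ℝ) (b : ι → ℝ) :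
    layerCost W b ≤ Fintype.card ι * Fintype.card κ + Fintype.card ι := by
  unfold layerCost
  refine add_le_add ?_ ?_
  · calc (∑ i, ∑ j, if W i j ≠ 0 then 1 else 0) ≤ ∑ _i : ι, ∑ _j : κ, 1 :=
          Finset.sum_le_sum fun i _ => Finset.sum_le_sum fun j _ => by split_ifs <;> omega
      _ = _ := by simp
  · calc (∑ i, if b i ≠ 0 then 1 else 0) ≤ ∑ _i : ι, 1 :=
          Finset.sum_le_sum fun i _ => by split_ifs <;> omega
      _ = _ := by simp

theorem affineNonzeros_eq_layerCost {h d : ℕ} (W : Matrix (Fin h) (Fin d) ℝ) (b : Fin h → ℝ) :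
    ReLUNet.affineNonzeros W b = layerCost (fun i j => W i j) b := by
  unfold ReLUNet.affineNonzeros layerCost
  rw [Finset.card_filter, Finset.card_filter, Fintype.sum_prod_type]

theorem layerCost_reindex {ι ι' κ κ' : Type} [Fintype ι] [Fintype κ] [Fintype ι'] [Fintype κ']
    (e : ι' ≃ ι) (e' : κ' ≃ κ) (W : ι → κ → ℝ) (b : ι → ℝ) :
    layerCost (fun i j => W (e i) (e' j)) (fun i => b (e i)) = layerCost W b := by
  unfold layerCost
  rw [← e.sum_comp, ← e.sum_comp (fun i => if b i ≠ 0 then 1 else 0)]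
  congr 1
  exact Finset.sum_congr rfl fun i _ => e'.sum_comp (fun j => if W (e i) j ≠ 0 then 1 else 0)

theorem IsHiddenState.mono {n L P Q : ℕ} {ι : Type} [Fintype ι] {S : (Fin n → ℝ) → ι → ℝ}
    (h : IsHiddenState L P S) (hPQ : P ≤ Q) : IsHiddenState L Q S := by
  cases L with
  | zero =>
    obtain ⟨W, b, hc, hS⟩ := h
    exact ⟨W, b, hc.trans hPQ, hS⟩
  | succ L =>
    obtain ⟨κ, iκ, R, T, hT, W, b, hc, hS⟩ := h
    exact ⟨κ, iκ, R, T, hT, W, b, hc.trans hPQ, hS⟩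

theorem IsHiddenState.layer {n L P : ℕ} {ι κ : Type} [Fintype ι] [Fintype κ]
    {S : (Fin n → ℝ) → κ → ℝ} (h : IsHiddenState L P S) (W : ι → κ → ℝ) (b : ι → ℝ) :
    IsHiddenState (L + 1) (P + (Fintype.card ι * Fintype.card κ + Fintype.card ι))
      (fun x => reluLayer W b (S x)) :=
  ⟨κ, _, P, S, h, W, b, Nat.add_le_add_left (layerCost_le W b) P, rfl⟩

theorem IsHiddenState.nonneg {n L P : ℕ} {ι : Type} [Fintype ι] {S : (Fin n → ℝ) → ι → ℝ}
    (h : IsHiddenState L P S) (x : Fin n → ℝ) (i : ι) : 0 ≤ S x i := by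
  cases L with
  | zero =>
    obtain ⟨W, b, hc, rfl⟩ := h
    exact le_max_right _ _
  | succ L =>
    obtain ⟨κ, iκ, R, T, hT, W, b, hc, rfl⟩ := h
    exact le_max_right _ _

/-- Precomposition with a permutation of the inputs costs nothing. -/
theorem IsHiddenState.permute {n L P : ℕ} {ι : Type} [Fintype ι] {S : (Fin n → ℝ) → ι → ℝ}
    (h : IsHiddenState L P S) (σ : Equiv.Perm (Fin n)) :
    IsHiddenState L P (fun x => S (permuteCoords σ x)) := by
  induction L generalizing P ι with
  | zero =>
    obtain ⟨W, b, hc, rfl⟩ := h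
    refine ⟨fun i j => W i (σ j), b, ?_, ?_⟩
    · exact (layerCost_reindex (Equiv.refl ι) σ W b).trans_le hc
    · funext x i
      simp only [reluLayer, permuteCoords]
      rw [← Equiv.sum_comp σ]
      simp
  | succ L ih =>
    obtain ⟨κ, iκ, R, T, hT, W, b, hc, rfl⟩ := h
    exact ⟨κ, iκ, R, _, ih hT, W, b, hc, rfl⟩

theorem reluLayer_sigma_input {K κ : Type} {ι : K → Type} [Fintype κ]
    (W : ∀ k, ι k → κ → ℝ) (b : ∀ k, ι k → ℝ) (v : κ → ℝ) (p : Σ k, ι k) :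
    reluLayer (fun q : Σ k, ι k => W q.1 q.2) (fun q => b q.1 q.2) v p =
      reluLayer (W p.1) (b p.1) v p.2 := rfl

theorem sum_sigma_dite {K : Type} [Fintype K] [DecidableEq K] {κ : K → Type}
    [∀ k, Fintype (κ k)] {M : Type} [AddCommMonoid M] (k : K) (f : κ k → M) :
    (∑ q : Σ k, κ k, if h : k = q.1 then f (h ▸ q.2) else 0) = ∑ j, f j := by
  rw [Fintype.sum_sigma, Finset.sum_eq_single k]
  · simp
  · intro k' _ hk'
    refine Finset.sum_eq_zero fun j _ => ?_
    rw [dif_neg (Ne.symm hk')]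
  · simp

/-- Networks of the same depth run in parallel. -/
theorem IsHiddenState.sigma {n L : ℕ} {K : Type} [Fintype K] {ι : K → Type} [∀ k, Fintype (ι k)]
    {P : K → ℕ} {S : ∀ k, (Fin n → ℝ) → ι k → ℝ} (h : ∀ k, IsHiddenState L (P k) (S k)) :
    IsHiddenState L (∑ k, P k) (fun x (p : Σ k, ι k) => S p.1 x p.2) := by
  classical
  induction L generalizing P ι with
  | zero =>
    choose W b hc hS using h
    refine ⟨fun p => W p.1 p.2, fun p => b p.1 p.2, ?_, ?_⟩
    · refine le_trans (le_of_eq ?_) (Finset.sum_le_sum fun k _ => hc k)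
      simp only [layerCost, Fintype.sum_sigma, Finset.sum_add_distrib]
    · funext x p
      rw [hS p.1, reluLayer_sigma_input]
  | succ L ih =>
    choose κ iκ Q T hT W b hc hS using h
    -- The combined weight matrix is block diagonal; its off-diagonal zeros are not counted, so the
    -- costs simply add.
    refine ⟨Σ k, κ k, inferInstance, ∑ k, Q k, fun x p => T p.1 x p.2, ih hT,
      fun p q => if h : p.1 = q.1 then W p.1 p.2 (h ▸ q.2) else 0, fun p => b p.1 p.2, ?_, ?_⟩
    · refine le_trans (le_of_eq ?_) (Finset.sum_le_sum fun k _ => hc k)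
      rw [Finset.sum_add_distrib]
      congr 1
      simp only [layerCost, Fintype.sum_sigma, Finset.sum_add_distrib]
      congr 1
      refine Finset.sum_congr rfl fun k _ => Finset.sum_congr rfl fun i _ => ?_
      rw [← sum_sigma_dite k (fun j => if W k i j ≠ 0 then 1 else 0), Fintype.sum_sigma]
      refine Finset.sum_congr rfl fun k' _ => Finset.sum_congr rfl fun j _ => ?_
      by_cases hk : k = k' <;> simp [hk]
    · funext x p
      obtain ⟨k, i⟩ := p
      simp only [hS k, reluLayer]
      congr 2
      rw [← sum_sigma_dite k (fun j => W k i j * T k x j)]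
      refine Finset.sum_congr rfl fun q _ => ?_
      obtain ⟨k', j⟩ := q
      by_cases hk : k = k'
      · subst hk; simp
      · simp [hk]

/-- Hidden states can be continued to networks. -/
theorem IsHiddenState.exists_net {n L P w k : ℕ} {ι : Type} [Fintype ι]
    {S : (Fin n → ℝ) → ι → ℝ} (h : IsHiddenState L P S) (e : ι ≃ Fin w) (R : ReLUNet k w) :
    ∃ N : ReLUNet k n, N.numLayers = L + 1 + R.numLayers ∧
      N.numNonzeroParams ≤ P + R.numNonzeroParams ∧
      ∀ x, N.eval x = R.eval (fun j => S x (e.symm j)) := by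
  induction L generalizing P ι w with
  | zero =>
    obtain ⟨W, b, hc, rfl⟩ := h
    refine ⟨.hidden (Matrix.of fun i j => W (e.symm i) j) (fun i => b (e.symm i)) R, ?_, ?_, ?_⟩
    · simp only [ReLUNet.numLayers]; omega
    · simp only [ReLUNet.numNonzeroParams, affineNonzeros_eq_layerCost]
      exact Nat.add_le_add_right
        ((layerCost_reindex e.symm (Equiv.refl _) W b).trans_le hc) _
    · intro x
      rfl
  | succ L ih =>
    obtain ⟨κ, iκ, Q, T, hT, W, b, hc, rfl⟩ := h
    let e' := Fintype.equivFin κ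
    -- The last layer of the state is moved to the front of `R`, which leaves a shallower state to
    -- continue.
    obtain ⟨N, h1, h2, h3⟩ := ih hT e'
      (.hidden (Matrix.of fun i j => W (e.symm i) (e'.symm j)) (fun i => b (e.symm i)) R)
    refine ⟨N, ?_, ?_, ?_⟩
    · rw [h1]; simp only [ReLUNet.numLayers]; omega
    · refine h2.trans ?_
      simp only [ReLUNet.numNonzeroParams, affineNonzeros_eq_layerCost]
      have := layerCost_reindex e.symm e'.symm W b
      simp only [Matrix.of_apply]
      omega
    · intro x
      rw [h3]
      simp only [ReLUNet.eval]
      congr 1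
      funext j
      simp only [reluLayer, Pi.add_apply, Matrix.mulVec, dotProduct, Matrix.of_apply]
      rw [Equiv.sum_comp e'.symm (fun j' => W (e.symm j) j' * T x j')]

/-! ### Single neurons -/

/-- `f` is the activation of a neuron after `L + 1` hidden layers with at most `P` nonzero
parameters in total. -/
def IsNeuron {n : ℕ} (L P : ℕ) (f : (Fin n → ℝ) → ℝ) : Prop :=
  IsHiddenState L P (fun x (_ : Unit) => f x)

namespace IsNeuron

variable {n L P Q : ℕ} {f g : (Fin n → ℝ) → ℝ}

theorem mono (h : IsNeuron L P f) (hPQ : P ≤ Q) : IsNeuron L Q f := IsHiddenState.mono h hPQ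

theorem nonneg (h : IsNeuron L P f) (x : Fin n → ℝ) : 0 ≤ f x := IsHiddenState.nonneg h x ()

theorem permute (h : IsNeuron L P f) (σ : Equiv.Perm (Fin n)) :
    IsNeuron L P (fun x => f (permuteCoords σ x)) := IsHiddenState.permute h σ

theorem relu_affine {J : Type} [Fintype J] {P : J → ℕ} {f : J → (Fin n → ℝ) → ℝ}
    (h : ∀ j, IsNeuron L (P j) (f j)) (w : J → ℝ) (b : ℝ) :
    IsNeuron (L + 1) (∑ j, P j + (Fintype.card J + 1)) (fun x => max (∑ j, w j * f j x + b) 0) := by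
  have h1 := (IsHiddenState.sigma h).layer (ι := Unit) (fun _ p => w p.1) (fun _ => b)
  unfold IsNeuron
  convert h1 using 1
  · simp
  · funext x _
    simp [reluLayer, Fintype.sum_sigma]

theorem relu_single (h : IsNeuron L P f) (w b : ℝ) :
    IsNeuron (L + 1) (P + 2) (fun x => max (w * f x + b) 0) := by
  simpa using relu_affine (J := Unit) (fun _ => h) (fun _ => w) b

theorem relu_pair (hf : IsNeuron L P f) (hg : IsNeuron L P g) (u v b : ℝ) :
    IsNeuron (L + 1) (2 * P + 3) (fun x => max (u * f x + v * g x + b) 0) := by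
  have := relu_affine (J := Fin 2) (P := fun _ => P) (f := ![f, g])
    (fun j => by fin_cases j <;> simpa) ![u, v] b
  simpa using this

/-- Activations are nonnegative, so the ReLU passes them on unchanged at the price of a single
weight. -/
theorem pad_one (h : IsNeuron L P f) : IsNeuron (L + 1) (P + 1) f := by
  refine ⟨Unit, _, P, _, h, fun _ _ => 1, fun _ => 0, ?_, ?_⟩
  · simp [layerCost]
  · funext x i
    simp [reluLayer, h.nonneg x]

theorem pad (h : IsNeuron L P f) (d : ℕ) : IsNeuron (L + d) (P + d) f := by
  induction d with
  | zero => exact h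
  | succ d ih => exact ih.pad_one

theorem base (w : Fin n → ℝ) (b : ℝ) :
    IsNeuron 0 (n + 1) (fun x : Fin n → ℝ => max (∑ i, w i * x i + b) 0) :=
  ⟨fun _ => w, fun _ => b, (layerCost_le _ _).trans (by simp), rfl⟩

end IsNeuron

/-! ### Approximate squaring -/

/-- The tent map, on `[0, 1]`. -/
noncomputable def tent (t : ℝ) : ℝ := 2 * t - 4 * max (t - 1 / 2) 0

theorem tent_mem {t : ℝ} (h0 : 0 ≤ t) (h1 : t ≤ 1) : 0 ≤ tent t ∧ tent t ≤ 1 := by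
  unfold tent
  rcases max_cases (t - 1 / 2) 0 with ⟨h, _⟩ | ⟨h, _⟩ <;> rw [h] <;> constructor <;> linarith

/-- On both branches `t - t ^ 2` equals `s / 2 - s ^ 2 / 4` with `s = tent t`, by the symmetry `t ↦
1 - t`. Iterating this self-similarity gains a factor `1 / 4` each time. -/
theorem sub_sq_eq_tent (t : ℝ) :
    t - t ^ 2 = tent t / 4 + (tent t - tent t ^ 2) / 4 := by
  unfold tent
  rcases max_cases (t - 1 / 2) 0 with ⟨h, _⟩ | ⟨h, _⟩ <;> rw [h] <;> ring

theorem tent_iterate_mem {t : ℝ} (h0 : 0 ≤ t) (h1 : t ≤ 1) (r : ℕ) :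
    0 ≤ tent^[r] t ∧ tent^[r] t ≤ 1 := by
  induction r with
  | zero => exact ⟨h0, h1⟩
  | succ r ih =>
    rw [Function.iterate_succ_apply']
    exact tent_mem ih.1 ih.2

/-- Partial sums of the expansion of `t - t ^ 2` into iterated tent maps. -/
noncomputable def sawtoothSum (r : ℕ) (t : ℝ) : ℝ :=
  ∑ s ∈ Finset.range r, tent^[s + 1] t / 4 ^ (s + 1)

theorem sawtoothSum_nonneg {t : ℝ} (h0 : 0 ≤ t) (h1 : t ≤ 1) (r : ℕ) : 0 ≤ sawtoothSum r t :=
  Finset.sum_nonneg fun s _ => div_nonneg (tent_iterate_mem h0 h1 _).1 (by positivity)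

theorem sub_sq_eq_sawtoothSum_add (r : ℕ) (t : ℝ) :
    t - t ^ 2 = sawtoothSum r t + (tent^[r] t - (tent^[r] t) ^ 2) / 4 ^ r := by
  induction r with
  | zero => simp [sawtoothSum]
  | succ r ih =>
    rw [ih, sub_sq_eq_tent, sawtoothSum, sawtoothSum, Finset.sum_range_succ,
      Function.iterate_succ_apply']
    field_simp
    ring

theorem abs_sub_sq_sub_sawtoothSum_le {t : ℝ} (h0 : 0 ≤ t) (h1 : t ≤ 1) (r : ℕ) :
    |t - t ^ 2 - sawtoothSum r t| ≤ (1 / 2) ^ r := by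
  rw [sub_sq_eq_sawtoothSum_add r t, add_sub_cancel_left]
  obtain ⟨h2, h3⟩ := tent_iterate_mem h0 h1 r
  have h4 : (0 : ℝ) < 4 ^ r := by positivity
  rw [abs_of_nonneg (div_nonneg (by nlinarith) h4.le)]
  calc (tent^[r] t - (tent^[r] t) ^ 2) / 4 ^ r ≤ 1 / 4 ^ r := by gcongr; nlinarith
    _ = (1 / 4) ^ r := by simp
    _ ≤ (1 / 2) ^ r := by gcongr; norm_num

namespace IsNeuron

variable {n L P : ℕ} {f : (Fin n → ℝ) → ℝ}

/-- Three neurons per layer suffice: the current iterate, its kink, and the running sum. All are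
nonnegative, so the sum survives the ReLU and constant width gives linear cost in `r`. -/
theorem sawtooth_state (hf : IsNeuron L P f) (h1 : ∀ x, f x ≤ 1) (r : ℕ) :
    IsHiddenState (L + 1 + r) (P + 6 + 12 * r) (fun x => ![tent^[r] (f x),
      max (tent^[r] (f x) - 1 / 2) 0, sawtoothSum r (f x)]) := by
  induction r with
  | zero =>
    have := IsHiddenState.layer (ι := Fin 3) hf ![fun _ => 1, fun _ => 1, fun _ => 0]
      ![0, -1 / 2, 0]
    convert this using 1
    · simp
    funext x i
    fin_cases i
    · simp [reluLayer, hf.nonneg]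
    · simp [reluLayer, sub_eq_add_neg, neg_div]
    · simp [reluLayer, sawtoothSum]
  | succ r ih =>
    have := IsHiddenState.layer (ι := Fin 3) (κ := Fin 3) ih
      ![![2, -4, 0], ![2, -4, 0], ![2 / 4 ^ (r + 1), -4 / 4 ^ (r + 1), 1]] ![0, -1 / 2, 0]
    convert this using 1
    · rfl
    · simp; ring
    funext x i
    have h3 := tent_iterate_mem (hf.nonneg x) (h1 x) (r + 1)
    have h4 := sawtoothSum_nonneg (hf.nonneg x) (h1 x) (r + 1)
    have h5 : tent^[r + 1] (f x) = 2 * tent^[r] (f x) - 4 * max (tent^[r] (f x) - 1 / 2) 0 := by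
      rw [Function.iterate_succ_apply', tent]
    have h6 : sawtoothSum (r + 1) (f x) =
        2 / 4 ^ (r + 1) * tent^[r] (f x) + -4 / 4 ^ (r + 1) * max (tent^[r] (f x) - 1 / 2) 0 +
          sawtoothSum r (f x) := by
      rw [sawtoothSum, Finset.sum_range_succ, h5, sawtoothSum]
      ring
    fin_cases i
    · simp only [reluLayer, Fin.sum_univ_three]
      simp only [Fin.zero_eta, Matrix.cons_val]
      rw [max_eq_left] <;> linarith [h3.1]
    · simp only [reluLayer, Fin.sum_univ_three]
      simp only [Fin.mk_one, Matrix.cons_val]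
      rw [h5]
      congr 1
      ring
    · simp only [reluLayer, Fin.sum_univ_three]
      simp only [Fin.reduceFinMk, Matrix.cons_val]
      rw [max_eq_left] <;> linarith

theorem sawtooth (hf : IsNeuron L P f) (h1 : ∀ x, f x ≤ 1) (r : ℕ) :
    IsNeuron (L + r + 2) (P + 12 * r + 10) (fun x => sawtoothSum r (f x)) := by
  have := IsHiddenState.layer (ι := Unit) (κ := Fin 3) (hf.sawtooth_state h1 r)
      (fun _ => ![0, 0, 1]) (fun _ => 0)
  have h2 : IsNeuron (L + 1 + r + 1) (P + 6 + 12 * r + (1 * 3 + 1))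
      (fun x => sawtoothSum r (f x)) := by
    unfold IsNeuron
    convert this using 1
    · simp
    funext x _
    simp [reluLayer, Fin.sum_univ_three, sawtoothSum_nonneg (hf.nonneg x) (h1 x) r]
  convert h2 using 1 <;> ring

end IsNeuron

/-! ### Approximate multiplication -/

/-- Projection to `[0, 1]` is 1-Lipschitz and fixes `z`. Products are clipped this way so that they
can be factors of further products. -/
theorem abs_clip_sub_le {y z δ : ℝ} (h0 : 0 ≤ z) (h1 : z ≤ 1) (h : |y - z| ≤ δ) :
    |max (1 - max (1 - y) 0) 0 - z| ≤ δ := by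
  rw [abs_le] at *
  rcases max_cases (1 - y) 0 with ⟨h2, _⟩ | ⟨h2, _⟩ <;> rw [h2] <;>
    [rcases max_cases (1 - (1 - y)) 0 with ⟨h3, _⟩ | ⟨h3, _⟩;
      rcases max_cases (1 - (0 : ℝ)) 0 with ⟨h3, _⟩ | ⟨h3, _⟩] <;> rw [h3] <;>
    constructor <;> linarith

/-- With `p = (f + g) / 2` and `q = |f - g| / 2`, both in `[0, 1]`, one has `f * g = p ^ 2 - q ^ 2`,
and each square is replaced by `t - sawtoothSum r t`. Two layers form `p` and `q`, `r + 2` compute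
the sawtooth sums, and two clip the result. -/
theorem IsNeuron.exists_mul {n L P : ℕ} {f g : (Fin n → ℝ) → ℝ} (hf : IsNeuron L P f)
    (hg : IsNeuron L P g) (hf1 : ∀ x, f x ≤ 1) (hg1 : ∀ x, g x ≤ 1) (r : ℕ) :
    ∃ m : (Fin n → ℝ) → ℝ, IsNeuron (L + r + 6) (16 * P + 48 * r + 83) m ∧ (∀ x, m x ≤ 1) ∧
      ∀ x, |f x * g x - m x| ≤ 2 * (1 / 2) ^ r := by
  have hL : L + r + 6 = L + 2 + r + 2 + 1 + 1 := by omega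
  rw [hL]
  have hp : IsNeuron (L + 2) (4 * P + 9) (fun x => (f x + g x) / 2) := by
    have h := (hf.relu_pair hg (1 / 2) (1 / 2) 0).pad_one.mono
      (show 2 * P + 3 + 1 ≤ 4 * P + 9 by omega)
    convert h using 1
    funext x
    have := hf.nonneg x
    have := hg.nonneg x
    rw [max_eq_left] <;> linarith
  have hq : IsNeuron (L + 2) (4 * P + 9) (fun x => |f x - g x| / 2) := by
    have h := (hf.relu_pair hg (1 / 2) (-1 / 2) 0).relu_pair
      (hf.relu_pair hg (-1 / 2) (1 / 2) 0) 1 1 0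
    convert h using 1
    · ring
    · funext x
      rcases le_total (f x) (g x) with hl | hl
      · rw [abs_of_nonpos (by linarith), max_eq_right (a := 1 / 2 * f x + -1 / 2 * g x + 0)
          (by linarith), max_eq_left (a := -1 / 2 * f x + 1 / 2 * g x + 0) (by linarith),
          max_eq_left] <;> linarith
      · rw [abs_of_nonneg (by linarith), max_eq_left (a := 1 / 2 * f x + -1 / 2 * g x + 0)
          (by linarith), max_eq_right (a := -1 / 2 * f x + 1 / 2 * g x + 0) (by linarith),
          max_eq_left] <;> linarith
  have hp1 : ∀ x, (f x + g x) / 2 ≤ 1 := fun x => by linarith [hf1 x, hg1 x]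
  have hq1 : ∀ x, |f x - g x| / 2 ≤ 1 := fun x => by
    have : |f x - g x| ≤ 1 := abs_le.2 ⟨by linarith [hf.nonneg x, hg1 x],
      by linarith [hf1 x, hg.nonneg x]⟩
    linarith
  -- This neuron is `max (1 - y) 0` for the approximate product `y`, the first half of the clipping;
  -- the inputs are first padded to a common depth.
  have h4 := IsNeuron.relu_affine (J := Fin 4) (P := fun _ => 4 * P + 12 * r + 19)
    (f := ![fun x => (f x + g x) / 2, fun x => |f x - g x| / 2,
      fun x => sawtoothSum r ((f x + g x) / 2), fun x => sawtoothSum r (|f x - g x| / 2)])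
    (L := L + 2 + r + 2) (fun j => by
      fin_cases j
      · exact ((hp.pad r).pad 2).mono (show _ ≤ 4 * P + 12 * r + 19 by omega)
      · exact ((hq.pad r).pad 2).mono (show _ ≤ 4 * P + 12 * r + 19 by omega)
      · exact (hp.sawtooth hp1 r).mono (show _ ≤ 4 * P + 12 * r + 19 by omega)
      · exact (hq.sawtooth hq1 r).mono (show _ ≤ 4 * P + 12 * r + 19 by omega)) ![-1, 1, 1, -1] 1
  refine ⟨_, (h4.relu_single (-1) 1).mono ?_, ?_, ?_⟩
  · simp; omega
  · intro x
    refine max_le ?_ zero_le_one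
    linarith [le_max_right (∑ j, (![-1, 1, 1, -1] : Fin 4 → ℝ) j * (![fun x => (f x + g x) / 2,
      fun x => |f x - g x| / 2, fun x => sawtoothSum r ((f x + g x) / 2),
      fun x => sawtoothSum r (|f x - g x| / 2)] : Fin 4 → (Fin n → ℝ) → ℝ) j x + 1) 0]
  · intro x
    have e1 := abs_sub_sq_sub_sawtoothSum_le (hp.nonneg x) (hp1 x) r
    have e2 := abs_sub_sq_sub_sawtoothSum_le (hq.nonneg x) (hq1 x) r
    have hc := abs_clip_sub_le (y := (f x + g x) / 2 - |f x - g x| / 2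
        - sawtoothSum r ((f x + g x) / 2) + sawtoothSum r (|f x - g x| / 2))
      (z := f x * g x) (δ := 2 * (1 / 2) ^ r)
      (mul_nonneg (hf.nonneg x) (hg.nonneg x)) (mul_le_one₀ (hf1 x) (hg.nonneg x) (hg1 x)) (by
        have : f x * g x = ((f x + g x) / 2) ^ 2 - (|f x - g x| / 2) ^ 2 := by
          rw [div_pow _ _ 2, div_pow _ _ 2, sq_abs]; ring
        rw [this]
        rw [abs_le] at *
        constructor <;> linarith [e1.1, e1.2, e2.1, e2.2])
    rw [abs_sub_comm] at hc
    convert hc using 5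
    simp only [Fin.sum_univ_four, Matrix.cons_val]
    rw [neg_one_mul, neg_add_eq_sub]
    congr 2
    ring

/-! ### Functions approximated at logarithmic cost -/

/-- For every `r`, the function `f` is within `C * 2⁻ʳ` of a linear combination of at most `C`
neurons with values in `[0, 1]`, with coefficients bounded by `C`, depth `C * (r + 1)` and at most
`2 * C * (r + 1)` nonzero parameters each. -/
def LogApprox {n : ℕ} (C : ℕ) (f : (Fin n → ℝ) → ℝ) : Prop :=
  ∀ r : ℕ, ∃ (J : Type) (_ : Fintype J) (c : J → ℝ) (g : J → (Fin n → ℝ) → ℝ),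
    Fintype.card J ≤ C ∧ (∀ j, |c j| ≤ C) ∧ (∀ j x, g j x ≤ 1) ∧
    (∀ j, IsNeuron (C * (r + 1)) (2 * C * (r + 1)) (g j)) ∧
    ∀ x, |f x - ∑ j, c j * g j x| ≤ C * (1 / 2) ^ r

/-- Padding adds at most `D` weights to the at most `D` parameters present, which explains the
factor `2` in `LogApprox`. -/
theorem IsNeuron.pad_to {n L P D : ℕ} {f : (Fin n → ℝ) → ℝ} (h : IsNeuron L P f) (hL : L ≤ D)
    (hP : P ≤ D) : IsNeuron D (2 * D) f := by
  have := (h.pad (D - L)).mono (show _ ≤ 2 * D by omega)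
  rwa [Nat.add_sub_cancel' hL] at this

theorem abs_sum_mul_le {J : Type} [Fintype J] {C : ℕ} {c u : J → ℝ} (hJ : Fintype.card J ≤ C)
    (hc : ∀ j, |c j| ≤ C) (hu : ∀ j, 0 ≤ u j ∧ u j ≤ 1) : |∑ j, c j * u j| ≤ C * C := by
  calc |∑ j, c j * u j| ≤ ∑ j, |c j * u j| := Finset.abs_sum_le_sum_abs _ _
    _ ≤ ∑ _j : J, (C : ℝ) := Finset.sum_le_sum fun j _ => by
        rw [abs_mul, abs_of_nonneg (hu j).1]
        exact (mul_le_of_le_one_right (abs_nonneg _) (hu j).2).trans (hc j)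
    _ = Fintype.card J * C := by simp
    _ ≤ C * C := by gcongr

namespace LogApprox

variable {n C D : ℕ} {f g : (Fin n → ℝ) → ℝ}

theorem mono (h : LogApprox C f) (hCD : C ≤ D) : LogApprox D f := by
  intro r
  obtain ⟨J, iJ, c, g, h1, h2, h3, h4, h5⟩ := h r
  have hCD' : (C : ℝ) ≤ D := by exact_mod_cast hCD
  refine ⟨J, iJ, c, g, h1.trans hCD, fun j => (h2 j).trans hCD', h3, fun j => ?_, fun x => ?_⟩
  · have hmul : C * (r + 1) ≤ D * (r + 1) := Nat.mul_le_mul_right _ hCD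
    have := ((h4 j).pad (D * (r + 1) - C * (r + 1))).mono
      (show _ ≤ 2 * D * (r + 1) by rw [mul_assoc, mul_assoc]; omega)
    rwa [Nat.add_sub_cancel' hmul] at this
  · exact (h5 x).trans (by gcongr)

theorem add (hf : LogApprox C f) (hg : LogApprox D g) :
    LogApprox (C + D) (fun x => f x + g x) := by
  intro r
  obtain ⟨J, iJ, c, u, h1, h2, h3, h4, h5⟩ := hf r
  obtain ⟨K, iK, d, v, k1, k2, k3, k4, k5⟩ := hg r
  have hpad : ∀ {A : ℕ} {w : (Fin n → ℝ) → ℝ}, A ≤ C + D →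
      IsNeuron (A * (r + 1)) (2 * A * (r + 1)) w →
      IsNeuron ((C + D) * (r + 1)) (2 * (C + D) * (r + 1)) w := by
    intro A w hA hw
    have hmul : A * (r + 1) ≤ (C + D) * (r + 1) := Nat.mul_le_mul_right _ hA
    have := (hw.pad ((C + D) * (r + 1) - A * (r + 1))).mono
      (show _ ≤ 2 * (C + D) * (r + 1) by rw [mul_assoc, mul_assoc]; omega)
    rwa [Nat.add_sub_cancel' hmul] at this
  refine ⟨J ⊕ K, inferInstance, Sum.elim c d, Sum.elim u v, ?_, ?_, ?_, ?_, ?_⟩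
  · rw [Fintype.card_sum]; omega
  · rintro (j | j)
    · exact (h2 j).trans (by push_cast; linarith [Nat.cast_nonneg (α := ℝ) D])
    · exact (k2 j).trans (by push_cast; linarith [Nat.cast_nonneg (α := ℝ) C])
  · rintro (j | j) x
    · exact h3 j x
    · exact k3 j x
  · rintro (j | j)
    · exact hpad (by omega) (h4 j)
    · exact hpad (by omega) (k4 j)
  · intro x
    simp only [Fintype.sum_sum_type, Sum.elim_inl, Sum.elim_inr]
    have e1 := h5 x
    have e2 := k5 x
    push_cast
    rw [abs_le] at *
    constructor <;> linarith [e1.1, e1.2, e2.1, e2.2]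

theorem of_isNeuron {L P : ℕ} (h : IsNeuron L P g) (h1 : ∀ x, g x ≤ 1) {c : ℝ} (hc : |c| ≤ C)
    (hL : L ≤ C) (hP : P ≤ C) (hC : 1 ≤ C) : LogApprox C (fun x => c * g x) := by
  intro r
  have hr : C ≤ C * (r + 1) := Nat.le_mul_of_pos_right _ (by omega)
  refine ⟨Unit, inferInstance, fun _ => c, fun _ => g, by simpa, fun _ => hc, fun _ => h1,
    fun _ => ?_, fun x => ?_⟩
  · rw [mul_assoc]
    exact h.pad_to (hL.trans hr) (hP.trans hr)
  · simp only [Finset.univ_unique, Finset.sum_singleton, sub_self, abs_zero]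
    positivity

theorem const {c : ℝ} (hc : |c| ≤ C) (hC : n + 1 ≤ C) : LogApprox C (fun _ : Fin n → ℝ => c) := by
  have h := IsNeuron.base (n := n) (fun _ => 0) 1
  have := of_isNeuron h (fun x => by simp) hc (by omega) (by omega) (by omega)
  simpa using this

theorem zero : LogApprox 0 (fun _ : Fin n → ℝ => (0 : ℝ)) := fun r =>
  ⟨Empty, inferInstance, fun e => e.elim, fun e => e.elim, by simp, fun e => e.elim,
    fun e => e.elim, fun e => e.elim, fun x => by simp⟩

theorem sum_range (k : ℕ) {f : ℕ → (Fin n → ℝ) → ℝ} (h : ∀ j < k, LogApprox C (f j)) :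
    LogApprox (k * C) (fun x => ∑ j ∈ Finset.range k, f j x) := by
  induction k with
  | zero => simpa using zero
  | succ k ih =>
    simp only [Finset.sum_range_succ, Nat.succ_mul]
    exact (ih fun j hj => h j (by omega)).add (h k (by omega))

theorem abs_le (h : LogApprox C f) (x : Fin n → ℝ) : |f x| ≤ C + C * C := by
  obtain ⟨J, iJ, c, g, h1, h2, h3, h4, h5⟩ := h 0
  have h6 : |∑ j, c j * g j x| ≤ C * C :=
    abs_sum_mul_le h1 h2 (fun j => ⟨(h4 j).nonneg x, h3 j x⟩)
  have h7 := h5 x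
  rw [pow_zero, mul_one] at h7
  calc |f x| = |(f x - ∑ j, c j * g j x) + ∑ j, c j * g j x| := by ring_nf
    _ ≤ _ := (abs_add_le _ _).trans (add_le_add h7 h6)

/-- The error splits into the error of `f` times `g`, the approximant of `f` times the error of `g`,
and the errors of the pairwise products. Their sizes are `C * (C + C ^ 2)`, `C ^ 3` and `2 * C ^ 4`
times `2⁻ʳ`; the remaining terms of the constant cover depth and parameters. -/
theorem mul (hf : LogApprox C f) (hg : LogApprox C g) :
    LogApprox (32 * C + 83 + 2 * C * C + 2 * C * C * C + 2 * C * C * C * C)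
      (fun x => f x * g x) := by
  intro r
  obtain ⟨J, iJ, c, u, h1, h2, h3, h4, h5⟩ := hf r
  obtain ⟨K, iK, d, v, k1, k2, k3, k4, k5⟩ := hg r
  choose m m1 m2 m3 using fun p : J × K =>
    (h4 p.1).exists_mul (k4 p.2) (h3 p.1) (k3 p.2) r
  set D := 32 * C + 83 + 2 * C * C + 2 * C * C * C + 2 * C * C * C * C with hD
  have hDC : 32 * C + 83 ≤ D := by rw [hD]; omega
  have hD2 : C * C ≤ D := by rw [hD, mul_assoc 2 C C]; omega
  have hr : (0 : ℝ) ≤ (1 / 2) ^ r := by positivity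
  have hC : (0 : ℝ) ≤ C := Nat.cast_nonneg _
  have hcd : ∀ p : J × K, |c p.1 * d p.2| ≤ (C : ℝ) * C := fun p => by
    rw [abs_mul]
    exact mul_le_mul (h2 _) (k2 _) (abs_nonneg _) hC
  refine ⟨J × K, inferInstance, fun p => c p.1 * d p.2, m, ?_, ?_, m2, ?_, ?_⟩
  · rw [Fintype.card_prod]
    exact (Nat.mul_le_mul h1 k1).trans hD2
  · exact fun p => (hcd p).trans (by exact_mod_cast hD2)
  · intro p
    rw [mul_assoc]
    refine (m1 p).pad_to ?_ ?_
    · calc C * (r + 1) + r + 6 ≤ (32 * C + 83) * (r + 1) := by nlinarith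
        _ ≤ _ := Nat.mul_le_mul_right _ hDC
    · calc 16 * (2 * C * (r + 1)) + 48 * r + 83 ≤ (32 * C + 83) * (r + 1) := by nlinarith
        _ ≤ _ := Nat.mul_le_mul_right _ hDC
  · intro x
    have e1 : |(f x - ∑ j, c j * u j x) * g x| ≤ C * (1 / 2) ^ r * (C + C * C) := by
      rw [abs_mul]
      exact mul_le_mul (h5 x) (hg.abs_le x) (abs_nonneg _) (by positivity)
    have hu : |∑ j, c j * u j x| ≤ C * C :=
      abs_sum_mul_le h1 h2 (fun j => ⟨(h4 j).nonneg x, h3 j x⟩)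
    have e2 : |(∑ j, c j * u j x) * (g x - ∑ j, d j * v j x)| ≤ C * C * (C * (1 / 2) ^ r) := by
      rw [abs_mul]
      exact mul_le_mul hu (k5 x) (abs_nonneg _) (by positivity)
    have e3 : |∑ p : J × K, c p.1 * d p.2 * (u p.1 x * v p.2 x - m p x)| ≤
        C * C * (C * C) * (2 * (1 / 2) ^ r) := by
      calc |∑ p : J × K, c p.1 * d p.2 * (u p.1 x * v p.2 x - m p x)|
          ≤ ∑ p : J × K, |c p.1 * d p.2 * (u p.1 x * v p.2 x - m p x)| :=
            Finset.abs_sum_le_sum_abs _ _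
        _ ≤ ∑ _p : J × K, (C : ℝ) * C * (2 * (1 / 2) ^ r) := Finset.sum_le_sum fun p _ => by
            rw [abs_mul]
            exact mul_le_mul (hcd p) (m3 p x) (abs_nonneg _) (by positivity)
        _ = (Fintype.card J * Fintype.card K : ℝ) * (C * C * (2 * (1 / 2) ^ r)) := by
            simp
        _ ≤ (C * C) * (C * C * (2 * (1 / 2) ^ r)) := by gcongr
        _ = _ := by ring
    have e4 : f x * g x - ∑ p : J × K, c p.1 * d p.2 * m p x =
        (f x - ∑ j, c j * u j x) * g x + (∑ j, c j * u j x) * (g x - ∑ j, d j * v j x) +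
          ∑ p : J × K, c p.1 * d p.2 * (u p.1 x * v p.2 x - m p x) := by
      have : (∑ j, c j * u j x) * (∑ j, d j * v j x) =
          ∑ p : J × K, c p.1 * d p.2 * (u p.1 x * v p.2 x) := by
        rw [Finset.sum_mul_sum, Fintype.sum_prod_type]
        exact Finset.sum_congr rfl fun i _ => Finset.sum_congr rfl fun j _ => by ring
      simp only [mul_sub, Finset.sum_sub_distrib]
      rw [← this]
      ring
    rw [e4]
    refine ((abs_add_three _ _ _).trans (add_le_add (add_le_add e1 e2) e3)).trans ?_
    rw [hD]
    push_cast
    nlinarith [mul_nonneg hC hr, mul_nonneg (mul_nonneg hC hC) hr]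

theorem exists_mul (n C : ℕ) : ∃ D, ∀ f g : (Fin n → ℝ) → ℝ, LogApprox C f → LogApprox C g →
    LogApprox D (fun x => f x * g x) := ⟨_, fun _ _ hf hg => hf.mul hg⟩

theorem exists_pow (n C k : ℕ) : ∃ D, ∀ f : (Fin n → ℝ) → ℝ, LogApprox C f → ∀ j ≤ k,
    LogApprox D (fun x => f x ^ j) := by
  induction k with
  | zero =>
    refine ⟨n + 1, fun f _ j hj => ?_⟩
    obtain rfl : j = 0 := by omega
    simpa using const (n := n) (c := 1) (C := n + 1) (by simp) le_rfl
  | succ k ih =>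
    obtain ⟨D, hD⟩ := ih
    obtain ⟨D', hD'⟩ := exists_mul n (max C D)
    refine ⟨max D D', fun f hf j hj => ?_⟩
    rcases Nat.lt_or_ge j (k + 1) with h | h
    · exact (hD f hf j (by omega)).mono (le_max_left _ _)
    · obtain rfl : j = k + 1 := by omega
      simp only [pow_succ]
      exact (hD' _ _ ((hD f hf k le_rfl).mono (le_max_right _ _))
        (hf.mono (le_max_left _ _))).mono (le_max_right _ _)

theorem exists_prod (n C : ℕ) {κ : Type} (s : Finset κ) :
    ∃ D, ∀ f : κ → (Fin n → ℝ) → ℝ, (∀ i, LogApprox C (f i)) →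
      LogApprox D (fun x => ∏ i ∈ s, f i x) := by
  classical
  induction s using Finset.induction_on with
  | empty =>
    refine ⟨n + 1, fun f _ => ?_⟩
    simpa using const (n := n) (c := 1) (C := n + 1) (by simp) le_rfl
  | insert i s hi ih =>
    obtain ⟨D, hD⟩ := ih
    obtain ⟨D', hD'⟩ := exists_mul n (max C D)
    refine ⟨D', fun f hf => ?_⟩
    simp only [Finset.prod_insert hi]
    exact hD' _ _ ((hf i).mono (le_max_left _ _)) ((hD f hf).mono (le_max_right _ _))

end LogApprox

/-! ### Coordinates and hat functions -/

/-- Projection of a real number to `[0, 1]`. -/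
noncomputable def clip (t : ℝ) : ℝ := max (1 - max (1 - max t 0) 0) 0

theorem clip_eq_self {t : ℝ} (h0 : 0 ≤ t) (h1 : t ≤ 1) : clip t = t := by
  unfold clip
  rw [max_eq_left h0, max_eq_left (by linarith : (0 : ℝ) ≤ 1 - t)]
  simpa using h0

/-- The coordinate is clipped because `LogApprox` asks for neurons with values in `[0, 1]` on the
whole space, not only on the cube. -/
theorem logApprox_clip {n : ℕ} (i : Fin n) : LogApprox (n + 7) (fun x => clip (x i)) := by
  classical
  have h := ((IsNeuron.base (n := n) (Pi.single i 1) 0).relu_single (-1) 1).relu_single (-1) 1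
  have h1 : ∀ x : Fin n → ℝ, (∑ j, (Pi.single i 1 : Fin n → ℝ) j * x j) = x i := fun x => by
    simp [Pi.single_apply]
  have h2 : IsNeuron (n := n) 2 (n + 7) (fun x => clip (x i)) := by
    refine IsNeuron.mono (P := n + 1 + 2 + 2) ?_ (by omega)
    convert h using 1
    funext x
    rw [h1, clip, add_zero, neg_one_mul, neg_one_mul, neg_add_eq_sub, neg_add_eq_sub]
  have := LogApprox.of_isNeuron (C := n + 7) (c := 1) h2 (fun x => ?_) (by
    rw [abs_one]; exact_mod_cast Nat.one_le_iff_ne_zero.2 (by omega)) (by omega) (by omega)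
    (by omega)
  · simpa using this
  · unfold clip
    refine max_le ?_ zero_le_one
    linarith [le_max_right (1 - max (x i) 0) 0]

/-- The piecewise linear hat function with support `[-1, 1]`. -/
noncomputable def hat (t : ℝ) : ℝ := max (1 - (max t 0 + max (-t) 0)) 0

theorem hat_nonneg (t : ℝ) : 0 ≤ hat t := le_max_right _ _

theorem abs_le_one_of_hat_ne_zero {t : ℝ} (h : hat t ≠ 0) : |t| ≤ 1 := by
  by_contra! h1
  apply h
  unfold hat
  apply max_eq_right
  rcases abs_cases t with ⟨h2, h3⟩ | ⟨h2, h3⟩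
  · linarith [le_max_left t 0, le_max_right (-t) 0]
  · linarith [le_max_right t 0, le_max_left (-t) 0]

/-- Written as a second difference of the ReLU, the integer translates of the hat have a telescoping
sum. -/
theorem hat_eq_second_difference (t : ℝ) :
    hat t = (max (t + 1) 0 - max t 0) - (max t 0 - max (t - 1) 0) := by
  unfold hat
  rcases le_total t 0 with h | h
  · rw [max_eq_right h, max_eq_left (by linarith : 0 ≤ -t),
      max_eq_right (by linarith : t - 1 ≤ 0)]
    ring_nf
  · rw [max_eq_left h, max_eq_right (by linarith : -t ≤ 0),
      max_eq_left (by linarith : 0 ≤ t + 1)]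
    rcases le_total t 1 with h' | h'
    · rw [max_eq_left (by linarith), max_eq_right (by linarith)]; ring
    · rw [max_eq_right (by linarith), max_eq_left (by linarith)]; ring

theorem sum_hat {N : ℕ} {t : ℝ} (h0 : 0 ≤ t) (h1 : t ≤ N) :
    ∑ k : Fin (N + 1), hat (t - (k : ℕ)) = 1 := by
  rw [Fin.sum_univ_eq_sum_range (fun k => hat (t - (k : ℕ)))]
  have h2 : ∀ k : ℕ, hat (t - k) =
      (fun k : ℕ => max (t - k + 1) 0 - max (t - k) 0) k -
        (fun k : ℕ => max (t - k + 1) 0 - max (t - k) 0) (k + 1) := by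
    intro k
    rw [hat_eq_second_difference]
    push_cast
    congr 3 <;> ring_nf
  rw [Finset.sum_congr rfl fun k _ => h2 k, Finset.sum_range_sub']
  push_cast
  rw [sub_zero, max_eq_left (by linarith : 0 ≤ t + 1), max_eq_left h0,
    max_eq_right (by linarith : t - (N + 1) + 1 ≤ 0), max_eq_right (by linarith)]
  ring

/-- The constant is free of `a` and `b`, since only the number of nonzero weights is counted; this
makes the cost of a grid bump independent of the mesh. -/
theorem logApprox_hat {n : ℕ} (i : Fin n) (a b : ℝ) :
    LogApprox (2 * n + 5) (fun x => hat (a * x i - b)) := by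
  classical
  have h := (IsNeuron.base (n := n) (Pi.single i a) (-b)).relu_pair
    (IsNeuron.base (n := n) (Pi.single i (-a)) b) (-1) (-1) 1
  have h1 : ∀ (x : Fin n → ℝ) (a : ℝ), (∑ j, (Pi.single i a : Fin n → ℝ) j * x j) = a * x i :=
    fun x a => by simp [Pi.single_apply]
  have h2 : IsNeuron (n := n) 1 (2 * n + 5) (fun x => hat (a * x i - b)) := by
    convert h using 1
    · ring
    · funext x
      rw [h1, h1, hat]
      ring_nf
  have := LogApprox.of_isNeuron (C := 2 * n + 5) (c := 1) h2 (fun x => ?_) (by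
    rw [abs_one]; exact_mod_cast Nat.one_le_iff_ne_zero.2 (by omega)) (by omega) (by omega)
    (by omega)
  · simpa using this
  · refine max_le ?_ zero_le_one
    linarith [le_max_right (a * x i - b) 0, le_max_right (-(a * x i - b)) 0]

/-- A partition of unity on the unit cube, subordinate to a grid of mesh `1 / N`. -/
noncomputable def gridBump {n : ℕ} (N : ℕ) (k : Fin n → Fin (N + 1)) (x : Fin n → ℝ) : ℝ :=
  ∏ i, hat (N * x i - (k i : ℕ))

theorem gridBump_nonneg {n N : ℕ} (k : Fin n → Fin (N + 1)) (x : Fin n → ℝ) :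
    0 ≤ gridBump N k x := Finset.prod_nonneg fun _ _ => hat_nonneg _

theorem sum_gridBump {n N : ℕ} {x : Fin n → ℝ} (hx : x ∈ unitCube n) :
    ∑ k : Fin n → Fin (N + 1), gridBump N k x = 1 := by
  unfold gridBump
  rw [← Fintype.piFinset_univ, ← Finset.prod_univ_sum (fun _ => Finset.univ)
    (fun i (k : Fin (N + 1)) => hat (N * x i - (k : ℕ)))]
  refine Finset.prod_eq_one fun i _ => sum_hat ?_ ?_
  · exact mul_nonneg (Nat.cast_nonneg _) (hx i).1
  · exact mul_le_of_le_one_right (Nat.cast_nonneg _) (hx i).2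

theorem abs_sub_le_of_gridBump_ne_zero {n N : ℕ} (hN : 0 < N) {k : Fin n → Fin (N + 1)}
    {x : Fin n → ℝ} (h : gridBump N k x ≠ 0) (i : Fin n) :
    |x i - (k i : ℕ) / (N : ℝ)| ≤ 1 / N := by
  have h1 := abs_le_one_of_hat_ne_zero (Finset.prod_ne_zero_iff.1 h i (Finset.mem_univ i))
  have hN' : (0 : ℝ) < N := by exact_mod_cast hN
  rw [show x i - (k i : ℕ) / (N : ℝ) = (N * x i - (k i : ℕ)) / N by field_simp, abs_div,
    abs_of_pos hN']
  gcongr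

theorem exists_logApprox_gridBump (n : ℕ) :
    ∃ C, ∀ (N : ℕ) (k : Fin n → Fin (N + 1)), LogApprox C (gridBump N k) := by
  obtain ⟨C, hC⟩ := LogApprox.exists_prod n (2 * n + 5) (Finset.univ : Finset (Fin n))
  exact ⟨C, fun N k => hC (fun i x => hat (N * x i - (k i : ℕ))) fun i => logApprox_hat i _ _⟩

/-! ### Local polynomial approximation of Hölder functions -/

/-- Here `g j` plays the role of the `j`-th derivative. The remainder vanishes at `a` and its
derivative is the remainder for the shifted sequence, so each integration by the mean value
inequality gains a factor `h`. -/
theorem abs_sub_taylor_le (k : ℕ) {g : ℕ → ℝ → ℝ} {H a h : ℝ} (ha : a ∈ Set.Icc (0 : ℝ) 1)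
    (hd : ∀ j < k, ∀ t ∈ Set.Icc (0 : ℝ) 1,
      HasDerivWithinAt (g j) (g (j + 1) t) (Set.Icc 0 1) t)
    (hH : ∀ t ∈ Set.Icc (0 : ℝ) 1, |t - a| ≤ h → |g k t - g k a| ≤ H) {t : ℝ}
    (ht : t ∈ Set.Icc (0 : ℝ) 1) (hta : |t - a| ≤ h) :
    |g 0 t - ∑ j ∈ Finset.range (k + 1), (j.factorial : ℝ)⁻¹ * (t - a) ^ j * g j a| ≤
      H * h ^ k := by
  induction k generalizing g t with
  | zero => simpa using hH t ht hta
  | succ k ih =>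
    have hh : 0 ≤ h := (abs_nonneg _).trans hta
    have hH0 : 0 ≤ H := (abs_nonneg _).trans (hH t ht hta)
    have ih' := fun {t : ℝ} => ih (g := fun j => g (j + 1)) (t := t)
      (fun j hj => hd (j + 1) (by omega)) hH
    set R : ℝ → ℝ := fun t =>
      g 0 t - ∑ j ∈ Finset.range (k + 1 + 1), (j.factorial : ℝ)⁻¹ * (t - a) ^ j * g j a with hR
    have hRd : ∀ t ∈ Set.Icc (0 : ℝ) 1, HasDerivWithinAt R (g 1 t -
        ∑ j ∈ Finset.range (k + 1), (j.factorial : ℝ)⁻¹ * (t - a) ^ j * g (j + 1) a)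
        (Set.Icc 0 1) t := by
      intro t ht
      refine (hd 0 (by omega) t ht).sub (HasDerivAt.hasDerivWithinAt ?_)
      simp only [Finset.sum_range_succ' _ (k + 1)]
      rw [← add_zero (∑ j ∈ Finset.range (k + 1), _)]
      refine HasDerivAt.add (HasDerivAt.fun_sum fun j _ => ?_) ?_
      · have h1 := ((((hasDerivAt_id t).sub_const a).pow (j + 1)).const_mul
          (((j + 1).factorial : ℝ)⁻¹)).mul_const (g (j + 1) a)
        refine HasDerivAt.congr_deriv h1 ?_
        have : ((j.factorial : ℕ) : ℝ) ≠ 0 := by exact_mod_cast j.factorial_ne_zero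
        rw [Nat.factorial_succ]
        push_cast
        simp only [id]
        field_simp
      · simpa using hasDerivAt_const t (g 0 a)
    have hRa : R a = 0 := by
      simp [hR, Finset.sum_range_succ']
    have hconv : Convex ℝ (Set.Icc (0 : ℝ) 1 ∩ Set.Icc (a - h) (a + h)) :=
      (convex_Icc _ _).inter (convex_Icc _ _)
    have habs : ∀ t : ℝ, t ∈ Set.Icc (a - h) (a + h) ↔ |t - a| ≤ h := fun t => by
      rw [abs_le, Set.mem_Icc]
      constructor <;> rintro ⟨h1, h2⟩ <;> constructor <;> linarith
    have h2 := hconv.norm_image_sub_le_of_norm_hasDerivWithin_le (C := H * h ^ k)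
      (fun t ht => (hRd t ht.1).mono Set.inter_subset_left)
      (fun t ht => ih' ht.1 ((habs t).1 ht.2))
      (show a ∈ _ from ⟨ha, (habs a).2 (by simpa using hh)⟩)
      (show t ∈ _ from ⟨ht, (habs t).2 hta⟩)
    rw [hRa, sub_zero, Real.norm_eq_abs, Real.norm_eq_abs] at h2
    calc |R t| ≤ H * h ^ k * |t - a| := h2
      _ ≤ H * h ^ k * h := by gcongr
      _ = H * h ^ (k + 1) := by ring

theorem update_mem_unitCube {n : ℕ} {x : Fin n → ℝ} (hx : x ∈ unitCube n) (i : Fin n) {t : ℝ}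
    (ht : t ∈ Set.Icc (0 : ℝ) 1) : Function.update x i t ∈ unitCube n := by
  intro j
  rcases eq_or_ne j i with rfl | hj
  · simpa using ht
  · simpa [hj] using hx j

theorem HasCubePartials.hasDerivWithinAt {n m : ℕ} {F : (Fin n → ℝ) → ℝ}
    (hF : HasCubePartials m F) {l : List (Fin n)} (hl : l.length < m) (i : Fin n)
    {x : Fin n → ℝ} (hx : x ∈ unitCube n) {t : ℝ} (ht : t ∈ Set.Icc (0 : ℝ) 1) :
    HasDerivWithinAt (fun t => cubeIterPartial l F (Function.update x i t))
      (cubeIterPartial (i :: l) F (Function.update x i t)) (Set.Icc 0 1) t := by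
  have := (hF l hl i _ (update_mem_unitCube hx i ht)).hasDerivWithinAt
  simpa [cubeIterPartial, cubePartial] using this

/-- Partial derivatives up to order `m` exist and are bounded by `M`; those of order `m` are
`(α - m)`-Hölder with constant `M`. -/
structure HolderBound {n : ℕ} (m : ℕ) (α M : ℝ) (F : (Fin n → ℝ) → ℝ) : Prop where
  hasCubePartials : HasCubePartials m F
  abs_le : ∀ l : List (Fin n), l.length ≤ m → ∀ x ∈ unitCube n, |cubeIterPartial l F x| ≤ M
  abs_sub_le : ∀ l : List (Fin n), l.length = m → ∀ x ∈ unitCube n, ∀ y ∈ unitCube n,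
    |cubeIterPartial l F x - cubeIterPartial l F y| ≤ M * ‖x - y‖ ^ (α - m)

theorem HolderBound.abs_sub_taylor_le {n m : ℕ} {α M : ℝ} {F : (Fin n → ℝ) → ℝ}
    (hF : HolderBound m α M F) (hα : m ≤ α) {l : List (Fin n)} {k : ℕ} (hl : k + l.length = m)
    (i : Fin n) {x : Fin n → ℝ} (hx : x ∈ unitCube n) {a h : ℝ} (ha : a ∈ Set.Icc (0 : ℝ) 1)
    (hh : 0 < h) (hxa : |x i - a| ≤ h) :
    |cubeIterPartial l F x - ∑ j ∈ Finset.range (k + 1), (j.factorial : ℝ)⁻¹ * (x i - a) ^ j *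
      cubeIterPartial (List.replicate j i ++ l) F (Function.update x i a)| ≤
      M * h ^ (α - l.length) := by
  have h0 := _root_.abs_sub_taylor_le k (a := a) (h := h) (H := M * h ^ (α - m)) (t := x i)
    (g := fun j t => cubeIterPartial (List.replicate j i ++ l) F (Function.update x i t)) ha
    (fun j hj t ht => hF.hasCubePartials.hasDerivWithinAt (by simp; omega) i hx ht)
    (fun t ht hta => by
      refine (hF.abs_sub_le _ (by simp; omega) _ (update_mem_unitCube hx i ht) _
        (update_mem_unitCube hx i ha)).trans ?_
      have hM : 0 ≤ M := (abs_nonneg _).trans (hF.abs_le l (by omega) x hx)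
      refine mul_le_mul_of_nonneg_left (Real.rpow_le_rpow (norm_nonneg _) ?_ (by linarith)) hM
      refine (pi_norm_le_iff_of_nonneg hh.le).2 fun j => ?_
      rcases eq_or_ne j i with rfl | hj
      · simpa using hta
      · simpa [hj] using hh.le) (hx i) hxa
  simp only [List.replicate_zero, List.nil_append, Function.update_eq_self] at h0
  refine h0.trans_eq ?_
  rw [mul_assoc, ← Real.rpow_natCast, ← Real.rpow_add hh]
  congr 2
  rw [← hl]
  push_cast
  ring

/-- Local approximation on slices of the cube in which only the coordinates in `S` are free. -/
theorem exists_logApprox_of_holderBound_slice (n m M : ℕ) (S : Finset (Fin n)) :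
    ∃ C : ℕ, ∀ (α : ℝ) (F : (Fin n → ℝ) → ℝ), (m : ℝ) ≤ α → HolderBound m α M F →
      ∀ a ∈ unitCube n, ∀ h : ℝ, 0 < h → ∀ l : List (Fin n), l.length ≤ m →
      ∃ p : (Fin n → ℝ) → ℝ, LogApprox C p ∧ (∀ x y, (∀ j ∈ S, x j = y j) → p x = p y) ∧
        ∀ x ∈ unitCube n, (∀ j ∉ S, x j = a j) → (∀ j, |x j - a j| ≤ h) →
          |cubeIterPartial l F x - p x| ≤ C * h ^ (α - l.length) := by
  classical
  induction S using Finset.induction_on with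
  | empty =>
    refine ⟨n + 1 + M, fun α F hα hF a ha h hh l hl => ⟨fun _ => cubeIterPartial l F a,
      LogApprox.const ((hF.abs_le l hl a ha).trans
        (by push_cast; linarith [Nat.cast_nonneg (α := ℝ) n])) (by omega),
      fun _ _ _ => rfl, fun x hx hxa _ => ?_⟩⟩
    obtain rfl : x = a := funext fun j => hxa j (by simp)
    rw [sub_self, abs_zero]
    positivity
  | insert i S hi ih =>
    obtain ⟨C, hC⟩ := ih
    obtain ⟨D₁, hD₁⟩ := LogApprox.exists_pow n (n + 7 + (n + 1)) m
    obtain ⟨D₂, hD₂⟩ := LogApprox.exists_mul n (max (n + 1) D₁)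
    obtain ⟨D₃, hD₃⟩ := LogApprox.exists_mul n (max D₂ C)
    refine ⟨(m + 1) * D₃ + (M + (m + 1) * C), fun α F hα hF a ha h hh l hl => ?_⟩
    obtain ⟨k, hk⟩ : ∃ k, k + l.length = m := ⟨m - l.length, by omega⟩
    have hlen : ∀ j, (List.replicate j i ++ l).length = j + l.length := by simp
    -- The coefficients of the Taylor expansion in coordinate `i` are derivatives restricted to the
    -- slice `x i = a i`, where the induction hypothesis applies. New derivatives are always
    -- prepended to `l`, so partial derivatives never have to commute.
    choose! p hp1 hp2 hp3 using fun j (hj : j < k + 1) =>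
      hC α F hα hF a ha h hh (List.replicate j i ++ l) (by rw [hlen]; omega)
    refine ⟨fun x => ∑ j ∈ Finset.range (k + 1),
      (j.factorial : ℝ)⁻¹ * (clip (x i) + -a i) ^ j * p j x, ?_, ?_, ?_⟩
    · refine (LogApprox.sum_range (C := D₃) (k + 1) fun j hj => hD₃ _ _
        ((hD₂ _ _ (LogApprox.mono (C := n + 1) (LogApprox.const ?_ le_rfl) (le_max_left _ _))
          ((hD₁ _ ((logApprox_clip i).add (LogApprox.const ?_ le_rfl)) j (by omega)).mono
            (le_max_right _ _))).mono (le_max_left _ _))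
        ((hp1 j hj).mono (le_max_right _ _))).mono ?_
      · rw [abs_of_nonneg (by positivity)]
        calc ((j.factorial : ℕ) : ℝ)⁻¹ ≤ 1 :=
              inv_le_one_of_one_le₀ (by exact_mod_cast j.factorial_pos)
          _ ≤ _ := by push_cast; linarith [Nat.cast_nonneg (α := ℝ) n]
      · rw [abs_neg, abs_of_nonneg (ha i).1]
        push_cast
        linarith [Nat.cast_nonneg (α := ℝ) n, (ha i).2]
      · exact (Nat.mul_le_mul_right _ (by omega)).trans (Nat.le_add_right _ _)
    · intro x y hxy
      refine Finset.sum_congr rfl fun j hj => ?_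
      rw [hxy i (Finset.mem_insert_self _ _), hp2 j (Finset.mem_range.1 hj) x y fun j' hj' =>
        hxy j' (Finset.mem_insert_of_mem hj')]
    · intro x hx hxa hxh
      have hT := hF.abs_sub_taylor_le hα hk i hx (ha i) hh (hxh i)
      have hx' := update_mem_unitCube hx i (ha i)
      have hp : ∀ j < k + 1,
          |cubeIterPartial (List.replicate j i ++ l) F (Function.update x i (a i)) - p j x| ≤
            C * h ^ (α - (j + l.length : ℕ)) := by
        intro j hj
        have := hp3 j hj _ hx' (fun j' hj' => by
          rcases eq_or_ne j' i with rfl | hne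
          · simp
          · simpa [hne] using hxa j' (by simp [hne, hj'])) (fun j' => by
          rcases eq_or_ne j' i with rfl | hne
          · simpa using hh.le
          · simpa [hne] using hxh j')
        rw [hlen] at this
        -- As `i ∉ S`, the approximant `p j` does not see coordinate `i` and may be evaluated at `x`
        -- itself.
        rwa [hp2 j hj _ x fun j' hj' => by
          exact Function.update_of_ne (ne_of_mem_of_not_mem hj' hi) _ _] at this
      have hsum : |∑ j ∈ Finset.range (k + 1), (j.factorial : ℝ)⁻¹ * (x i - a i) ^ j *
          (cubeIterPartial (List.replicate j i ++ l) F (Function.update x i (a i)) - p j x)| ≤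
          (m + 1) * (C * h ^ (α - l.length)) := by
        calc _ ≤ ∑ j ∈ Finset.range (k + 1), |(j.factorial : ℝ)⁻¹ * (x i - a i) ^ j *
              (cubeIterPartial (List.replicate j i ++ l) F (Function.update x i (a i)) - p j x)| :=
              Finset.abs_sum_le_sum_abs _ _
          _ ≤ ∑ _j ∈ Finset.range (k + 1), C * h ^ (α - l.length) := by
              refine Finset.sum_le_sum fun j hj => ?_
              have hj' := Finset.mem_range.1 hj
              have hf : ((j.factorial : ℕ) : ℝ)⁻¹ ≤ 1 :=
                inv_le_one_of_one_le₀ (by exact_mod_cast j.factorial_pos)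
              rw [abs_mul, abs_mul, abs_pow, abs_of_nonneg (by positivity :
                (0 : ℝ) ≤ (j.factorial : ℝ)⁻¹)]
              calc (j.factorial : ℝ)⁻¹ * |x i - a i| ^ j * _
                  ≤ 1 * h ^ j * (C * h ^ (α - (j + l.length : ℕ))) := by
                    gcongr
                    · exact hxh i
                    · exact hp j hj'
                _ = C * (h ^ (j : ℝ) * h ^ (α - (j + l.length : ℕ))) := by
                    rw [Real.rpow_natCast]; ring
                _ = C * h ^ (α - l.length) := by
                    rw [← Real.rpow_add hh]; push_cast; congr 2; ring
          _ = (k + 1 : ℝ) * (C * h ^ (α - l.length)) := by simp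
          _ ≤ (m + 1) * (C * h ^ (α - l.length)) := by
              gcongr
              omega
      have hsplit : cubeIterPartial l F x - ∑ j ∈ Finset.range (k + 1),
          (j.factorial : ℝ)⁻¹ * (clip (x i) + -a i) ^ j * p j x =
          (cubeIterPartial l F x - ∑ j ∈ Finset.range (k + 1),
            (j.factorial : ℝ)⁻¹ * (x i - a i) ^ j *
              cubeIterPartial (List.replicate j i ++ l) F (Function.update x i (a i))) +
          ∑ j ∈ Finset.range (k + 1), (j.factorial : ℝ)⁻¹ * (x i - a i) ^ j *
            (cubeIterPartial (List.replicate j i ++ l) F (Function.update x i (a i)) - p j x) := by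
        rw [clip_eq_self (hx i).1 (hx i).2]
        simp only [mul_sub, Finset.sum_sub_distrib, ← sub_eq_add_neg]
        ring
      rw [hsplit]
      refine ((abs_add_le _ _).trans (add_le_add hT hsum)).trans ?_
      have h1 : 0 ≤ h ^ (α - l.length) := Real.rpow_nonneg hh.le _
      have h2 : (0 : ℝ) ≤ ((m + 1) * D₃ : ℕ) * h ^ (α - l.length) := by positivity
      push_cast at h2 ⊢
      linarith

theorem exists_logApprox_of_holderBound (n m M : ℕ) :
    ∃ C : ℕ, ∀ (α : ℝ) (F : (Fin n → ℝ) → ℝ), (m : ℝ) ≤ α → HolderBound m α M F →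
      ∀ a ∈ unitCube n, ∀ h : ℝ, 0 < h → ∃ p : (Fin n → ℝ) → ℝ, LogApprox C p ∧
        ∀ x ∈ unitCube n, (∀ j, |x j - a j| ≤ h) → |F x - p x| ≤ C * h ^ α := by
  obtain ⟨C, hC⟩ := exists_logApprox_of_holderBound_slice n m M Finset.univ
  refine ⟨C, fun α F hα hF a ha h hh => ?_⟩
  obtain ⟨p, hp1, -, hp2⟩ := hC α F hα hF a ha h hh [] (by simp)
  refine ⟨p, hp1, fun x hx hxa => ?_⟩
  simpa [cubeIterPartial] using hp2 x hx (by simp) hxa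

/-! ### Bounds for functions in a Hölder ball -/

theorem abs_cubeIterPartial_le {n : ℕ} {α B : ℝ} (hB : 0 ≤ B) {F : (Fin n → ℝ) → ℝ}
    (hF : F ∈ holderBall n α B) {l : List (Fin n)} (hl : l.length < ⌊α⌋₊) {x : Fin n → ℝ}
    (hx : x ∈ unitCube n) : |cubeIterPartial l F x| ≤ B := by
  have h := le_self_add.trans hF.2.2
  simp only [iSup_le_iff] at h
  exact (ENNReal.ofReal_le_ofReal_iff hB).1 (h l hl x hx)

theorem abs_cubeIterPartial_sub_le {n : ℕ} {α B : ℝ} (hB : 0 ≤ B) {F : (Fin n → ℝ) → ℝ}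
    (hF : F ∈ holderBall n α B) {l : List (Fin n)} (hl : l.length = ⌊α⌋₊) {x y : Fin n → ℝ}
    (hx : x ∈ unitCube n) (hy : y ∈ unitCube n) :
    |cubeIterPartial l F x - cubeIterPartial l F y| ≤ B * ‖x - y‖ ^ (α - (⌊α⌋₊ : ℝ)) := by
  rcases eq_or_ne x y with rfl | hxy
  · rw [sub_self, abs_zero]
    positivity
  have h := le_add_self.trans hF.2.2
  simp only [iSup_le_iff] at h
  have h1 := (ENNReal.ofReal_le_ofReal_iff hB).1 (h l hl x hx y hy hxy)
  exact (div_le_iff₀ (Real.rpow_pos_of_pos (norm_pos_iff.2 (sub_ne_zero.2 hxy)) _)).1 h1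

theorem norm_sub_le_one_of_mem_unitCube {n : ℕ} {x y : Fin n → ℝ} (hx : x ∈ unitCube n)
    (hy : y ∈ unitCube n) : ‖x - y‖ ≤ 1 := by
  refine (pi_norm_le_iff_of_nonneg zero_le_one).2 fun i => ?_
  rw [Pi.sub_apply, Real.norm_eq_abs, abs_le]
  constructor <;> linarith [(hx i).1, (hx i).2, (hy i).1, (hy i).2]

/-- Functions in a Hölder ball have bounded derivatives after subtraction of a constant. -/
theorem exists_holderBound_sub_const {n : ℕ} {α B : ℝ} (hα : 0 < α) (hB : 0 ≤ B)
    {F : (Fin n → ℝ) → ℝ} (hF : F ∈ holderBall n α B) :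
    ∃ c : ℝ, HolderBound ⌊α⌋₊ α (⌈3 * B⌉₊ : ℕ) (fun x => F x - c) := by
  have hs : 0 ≤ α - (⌊α⌋₊ : ℝ) := sub_nonneg.2 (Nat.floor_le hα.le)
  have hM : 3 * B ≤ (⌈3 * B⌉₊ : ℕ) := Nat.le_ceil _
  have hosc : ∀ {l : List (Fin n)}, l.length = ⌊α⌋₊ → ∀ {x y : Fin n → ℝ}, x ∈ unitCube n →
      y ∈ unitCube n → |cubeIterPartial l F x - cubeIterPartial l F y| ≤ B := by
    intro l hl x y hx hy
    refine (abs_cubeIterPartial_sub_le hB hF hl hx hy).trans (mul_le_of_le_one_right hB ?_)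
    exact Real.rpow_le_one (norm_nonneg _) (norm_sub_le_one_of_mem_unitCube hx hy) hs
  have hsub : ∀ l : List (Fin n), l.length = ⌊α⌋₊ → ∀ x ∈ unitCube n, ∀ y ∈ unitCube n,
      |cubeIterPartial l F x - cubeIterPartial l F y| ≤
        (⌈3 * B⌉₊ : ℕ) * ‖x - y‖ ^ (α - (⌊α⌋₊ : ℝ)) := by
    intro l hl x hx y hy
    refine (abs_cubeIterPartial_sub_le hB hF hl hx hy).trans ?_
    gcongr
    linarith
  -- When `⌊α⌋₊ = 0` the norm controls only the oscillation of `F`, so `F 0` has to be subtracted.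
  rcases Nat.eq_zero_or_pos ⌊α⌋₊ with h0 | h0
  · refine ⟨F 0, ?_, ?_, ?_⟩
    · intro l hl; omega
    · intro l hl x hx
      obtain rfl : l = [] := List.length_eq_zero_iff.1 (by omega)
      have := hosc (l := []) (by simp [h0]) hx (y := 0) (fun i => by simp)
      simp only [cubeIterPartial] at this ⊢
      linarith
    · intro l hl x hx y hy
      obtain rfl : l = [] := List.length_eq_zero_iff.1 (by omega)
      simpa [cubeIterPartial] using hsub [] (by simp [h0]) x hx y hy
  · refine ⟨0, ?_⟩
    simp only [sub_zero]
    refine ⟨hF.2.1, fun l hl x hx => ?_, hsub⟩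
    rcases hl.lt_or_eq with hl | hl
    · exact (abs_cubeIterPartial_le hB hF hl hx).trans (by linarith)
    · cases l with
      | nil => simp at hl; omega
      | cons i l =>
        have hl' : l.length < ⌊α⌋₊ := by simp at hl; omega
        have hd : ∀ t ∈ Set.Icc (0 : ℝ) 1, _ := fun t ht =>
          hF.2.1.hasDerivWithinAt hl' i hx ht
        -- Top-order derivatives are not bounded by the norm directly. The mean value theorem across
        -- the cube gives a point where this one is at most `2 * B`, and its oscillation adds at
        -- most `B`.
        obtain ⟨t, ht, hslope⟩ := exists_hasDerivAt_eq_slope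
          (fun t => cubeIterPartial l F (Function.update x i t))
          (fun t => cubeIterPartial (i :: l) F (Function.update x i t)) zero_lt_one
          (fun t ht => (hd t ht).continuousWithinAt)
          (fun t ht => (hd t (Set.Ioo_subset_Icc_self ht)).hasDerivAt (Icc_mem_nhds ht.1 ht.2))
        have ht' := Set.Ioo_subset_Icc_self ht
        have b0 := abs_cubeIterPartial_le hB hF hl' (update_mem_unitCube hx i (t := 0) (by simp))
        have b1 := abs_cubeIterPartial_le hB hF hl' (update_mem_unitCube hx i (t := 1) (by simp))
        have b2 := hosc hl hx (update_mem_unitCube hx i ht')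
        rw [hslope] at b2
        rw [sub_zero, div_one] at b2
        rw [abs_le] at *
        constructor <;> linarith [b0.1, b0.2, b1.1, b1.2, b2.1, b2.2]

/-! ### Global approximation -/

/-- The bumps are nonnegative with sum `1`, so the global error is a weighted mean of local errors.
The constant `b` stays separate, being unbounded over the Hölder ball when `α < 1`; it becomes the
output bias. -/
theorem exists_logApprox_grid (n : ℕ) {α B : ℝ} (hα : 0 < α) (hB : 0 ≤ B) :
    ∃ C : ℕ, ∀ F ∈ holderBall n α B, ∀ N : ℕ, 0 < N →
      ∃ (b : ℝ) (q : (Fin n → Fin (N + 1)) → (Fin n → ℝ) → ℝ), (∀ k, LogApprox C (q k)) ∧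
        ∀ x ∈ unitCube n, |F x - (b + ∑ k, q k x)| ≤ C * (1 / (N : ℝ)) ^ α := by
  obtain ⟨C₁, hC₁⟩ := exists_logApprox_of_holderBound n ⌊α⌋₊ ⌈3 * B⌉₊
  obtain ⟨C₂, hC₂⟩ := exists_logApprox_gridBump n
  obtain ⟨C₃, hC₃⟩ := LogApprox.exists_mul n (max C₁ C₂)
  refine ⟨max C₁ C₃, fun F hF N hN => ?_⟩
  have hN' : (0 : ℝ) < N := by exact_mod_cast hN
  obtain ⟨b, hb⟩ := exists_holderBound_sub_const hα hB hF
  choose p hp1 hp2 using fun k : Fin n → Fin (N + 1) =>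
    hC₁ α _ (Nat.floor_le hα.le) hb (fun i => (k i : ℕ) / (N : ℝ)) (fun i =>
      ⟨by positivity, div_le_one_of_le₀ (by exact_mod_cast Nat.lt_succ_iff.1 (k i).2) hN'.le⟩)
      (1 / N) (by positivity)
  refine ⟨b, fun k x => gridBump N k x * p k x, fun k =>
    (hC₃ _ _ ((hC₂ N k).mono (le_max_right _ _)) ((hp1 k).mono (le_max_left _ _))).mono
      (le_max_right _ _), fun x hx => ?_⟩
  have h1 : F x - (b + ∑ k, gridBump N k x * p k x) =
      ∑ k : Fin n → Fin (N + 1), gridBump N k x * (F x - b - p k x) := by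
    simp only [mul_sub, Finset.sum_sub_distrib, ← Finset.sum_mul, sum_gridBump hx]
    ring
  rw [h1]
  calc |∑ k : Fin n → Fin (N + 1), gridBump N k x * (F x - b - p k x)|
      ≤ ∑ k : Fin n → Fin (N + 1), |gridBump N k x * (F x - b - p k x)| :=
        Finset.abs_sum_le_sum_abs _ _
    _ ≤ ∑ k : Fin n → Fin (N + 1), gridBump N k x * (C₁ * (1 / (N : ℝ)) ^ α) := by
        refine Finset.sum_le_sum fun k _ => ?_
        rw [abs_mul, abs_of_nonneg (gridBump_nonneg k x)]
        rcases eq_or_ne (gridBump N k x) 0 with h0 | h0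
        · rw [h0, zero_mul, zero_mul]
        · exact mul_le_mul_of_nonneg_left
            (hp2 k x hx (abs_sub_le_of_gridBump_ne_zero hN h0)) (gridBump_nonneg k x)
    _ = C₁ * (1 / (N : ℝ)) ^ α := by rw [← Finset.sum_mul, sum_gridBump hx, one_mul]
    _ ≤ (max C₁ C₃ : ℕ) * (1 / (N : ℝ)) ^ α := by
        gcongr
        exact le_max_left _ _

/-! ### Averaging over the group -/

theorem permuteCoords_mul {n : ℕ} (σ τ : Equiv.Perm (Fin n)) (x : Fin n → ℝ) :
    permuteCoords σ (permuteCoords τ x) = permuteCoords (σ * τ) x := by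
  funext i
  simp [permuteCoords, mul_inv_rev]

theorem permuteCoords_mem_unitCube {n : ℕ} (σ : Equiv.Perm (Fin n)) {x : Fin n → ℝ}
    (hx : x ∈ unitCube n) : permuteCoords σ x ∈ unitCube n := fun _ => hx _

/-- A linear combination of neurons, averaged over a group of permutations of the inputs, is
computed by a network. -/
theorem exists_net_average {n L P : ℕ} (G : Subgroup (Equiv.Perm (Fin n))) [Fintype G] {J : Type}
    [Fintype J] {g : J → (Fin n → ℝ) → ℝ} (hg : ∀ j, IsNeuron L P (g j)) (c : J → ℝ) (b : ℝ) :
    ∃ N : ReLUNet 1 n, N.numLayers = L + 2 ∧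
      N.numNonzeroParams ≤ Fintype.card G * Fintype.card J * (P + 1) + 1 ∧
      ∀ x, N.eval x 0 = (Fintype.card G : ℝ)⁻¹ *
        ∑ σ : G, (b + ∑ j, c j * g j (permuteCoords (σ : Equiv.Perm (Fin n)) x)) := by
  have h := IsHiddenState.sigma (K := G × J) (ι := fun _ => Unit) (P := fun _ => P)
    (S := fun p x _ => g p.2 (permuteCoords (p.1 : Equiv.Perm (Fin n)) x))
    (fun p => (hg p.2).permute p.1)
  let e := Fintype.equivFin (Σ _ : G × J, Unit)
  obtain ⟨N, h1, h2, h3⟩ := h.exists_net e (.output (k := 1)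
    (Matrix.of fun _ i => (Fintype.card G : ℝ)⁻¹ * c (e.symm i).1.2) (fun _ => b))
  refine ⟨N, h1, h2.trans ?_, fun x => ?_⟩
  · simp only [ReLUNet.numNonzeroParams, affineNonzeros_eq_layerCost]
    refine (Nat.add_le_add_left (layerCost_le _ _) _).trans (le_of_eq ?_)
    simp
    ring
  · rw [h3]
    simp only [ReLUNet.eval, Pi.add_apply, Matrix.mulVec, dotProduct, Matrix.of_apply]
    rw [Equiv.sum_comp e.symm (fun q : Σ _ : G × J, Unit => (Fintype.card G : ℝ)⁻¹ * c q.1.2 *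
      g q.1.2 (permuteCoords (q.1.1 : Equiv.Perm (Fin n)) x))]
    have hG : (Fintype.card G : ℝ) ≠ 0 := by exact_mod_cast Fintype.card_ne_zero
    rw [Fintype.sum_sigma, Fintype.sum_prod_type]
    simp only [Finset.univ_unique, Finset.sum_add_distrib, mul_add, Finset.sum_const,
      Finset.card_singleton, Nat.cast_one, one_mul, Finset.card_univ, nsmul_eq_mul, Finset.mul_sum]
    rw [inv_mul_cancel_left₀ hG, add_comm]
    simp only [mul_assoc]

theorem exists_invariant_net {n : ℕ} (G : Subgroup (Equiv.Perm (Fin n))) [Fintype G] {α B : ℝ}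
    (hα : 0 < α) (hB : 0 ≤ B) :
    ∃ C : ℕ, ∀ F ∈ holderBall n α B, IsInvariantOnCube G F → ∀ N : ℕ, 0 < N → ∀ r : ℕ,
      ∃ R ∈ invariantReLUNets G (C * (r + 1) + 2)
          (Fintype.card G * ((N + 1) ^ n * C) * (2 * C * (r + 1) + 1) + 1),
        ∀ x ∈ unitCube n,
          |R.eval x 0 - F x| ≤ C * (1 / (N : ℝ)) ^ α + (N + 1) ^ n * (C * (1 / 2) ^ r) := by
  obtain ⟨C, hC⟩ := exists_logApprox_grid n hα hB
  refine ⟨C, fun F hF hFG N hN r => ?_⟩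
  obtain ⟨b, q, hq, hFq⟩ := hC F hF N hN
  choose J iJ c g h1 h2 h3 h4 h5 using fun k => hq k r
  obtain ⟨R, hR1, hR2, hR3⟩ := exists_net_average G (J := Σ k, J k) (g := fun p => g p.1 p.2)
    (fun p => h4 p.1 p.2) (fun p => c p.1 p.2) b
  have hG : (0 : ℝ) < Fintype.card G := by exact_mod_cast Fintype.card_pos
  have herr : ∀ x ∈ unitCube n, |(b + ∑ p : Σ k, J k, c p.1 p.2 * g p.1 p.2 x) - F x| ≤
      C * (1 / (N : ℝ)) ^ α + (N + 1) ^ n * (C * (1 / 2) ^ r) := by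
    intro x hx
    have e1 : |∑ k, (q k x - ∑ j, c k j * g k j x)| ≤ (N + 1) ^ n * (C * (1 / 2) ^ r) := by
      calc _ ≤ ∑ k, |q k x - ∑ j, c k j * g k j x| := Finset.abs_sum_le_sum_abs _ _
        _ ≤ ∑ _k : Fin n → Fin (N + 1), (C : ℝ) * (1 / 2) ^ r :=
            Finset.sum_le_sum fun k _ => h5 k x
        _ = _ := by simp
    rw [abs_sub_comm, Fintype.sum_sigma]
    have e2 : F x - (b + ∑ k, ∑ j, c k j * g k j x) = (F x - (b + ∑ k, q k x)) +
        ∑ k, (q k x - ∑ j, c k j * g k j x) := by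
      rw [Finset.sum_sub_distrib]
      ring
    rw [e2]
    exact (abs_add_le _ _).trans (add_le_add (hFq x hx) e1)
  refine ⟨R, ⟨hR1.le, hR2.trans ?_, ?_⟩, fun x hx => ?_⟩
  · gcongr
    rw [Fintype.card_sigma]
    calc ∑ k, Fintype.card (J k) ≤ ∑ _k : Fin n → Fin (N + 1), C :=
          Finset.sum_le_sum fun k _ => h1 k
      _ = (N + 1) ^ n * C := by simp
  · intro τ hτ x _
    simp only [hR3, permuteCoords_mul]
    congr 1
    -- Right translation by `τ` permutes the summands of the average.
    exact Equiv.sum_comp (Equiv.mulRight (⟨τ, hτ⟩ : G)) (fun σ : G => b + ∑ p : Σ k, J k,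
      c p.1 p.2 * g p.1 p.2 (permuteCoords (σ : Equiv.Perm (Fin n)) x))
  · rw [hR3]
    set H : (Fin n → ℝ) → ℝ := fun x => b + ∑ p : Σ k, J k, c p.1 p.2 * g p.1 p.2 x
    have e1 : (Fintype.card G : ℝ)⁻¹ * (∑ σ : G, H (permuteCoords (σ : Equiv.Perm (Fin n)) x)) -
        F x = (Fintype.card G : ℝ)⁻¹ * ∑ σ : G, (H (permuteCoords (σ : Equiv.Perm (Fin n)) x) -
          F (permuteCoords (σ : Equiv.Perm (Fin n)) x)) := by
      rw [Finset.sum_sub_distrib, Finset.sum_congr rfl fun (σ : G) _ => hFG σ σ.2 x hx]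
      simp only [Finset.sum_const, Finset.card_univ, nsmul_eq_mul]
      rw [mul_sub, inv_mul_cancel_left₀ hG.ne']
    rw [e1, abs_mul, abs_of_pos (inv_pos.2 hG), inv_mul_le_iff₀ hG]
    refine (Finset.abs_sum_le_sum_abs _ _).trans ((Finset.sum_le_sum fun (σ : G) _ =>
      herr _ (permuteCoords_mem_unitCube σ hx)).trans_eq ?_)
    rw [Finset.sum_const, Finset.card_univ, nsmul_eq_mul]

/-! ### Choice of the parameters -/

theorem exists_grid_size {α : ℝ} (hα : 0 < α) (n C : ℕ) :
    ∃ Q : ℝ, 0 ≤ Q ∧ ∀ ε : ℝ, 0 < ε → ε ≤ 1 → ∃ N : ℕ, 0 < N ∧ C * (1 / (N : ℝ)) ^ α ≤ ε / 2 ∧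
      ((N : ℝ) + 1) ^ n ≤ Q * ε ^ (-((n : ℝ) / α)) := by
  -- `K` solves `(C + 1) * K ^ (-α) = 1 / 2`; using `C + 1` keeps it positive when `C = 0`.
  set K : ℝ := (2 * (C + 1)) ^ (1 / α) with hK
  have hK0 : 0 < K := Real.rpow_pos_of_pos (by positivity) _
  refine ⟨(K + 2) ^ n, by positivity, fun ε hε hε1 => ?_⟩
  set u : ℝ := ε ^ (-(1 / α)) with hu
  have hu1 : 1 ≤ u := Real.one_le_rpow_of_pos_of_le_one_of_nonpos hε hε1
    (neg_nonpos.2 (by positivity))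
  have hKu : 0 < K * u := by positivity
  refine ⟨⌈K * u⌉₊, Nat.ceil_pos.2 hKu, ?_, ?_⟩
  · have h1 : (1 / (⌈K * u⌉₊ : ℝ)) ^ α ≤ ε / (2 * (C + 1)) := by
      calc (1 / (⌈K * u⌉₊ : ℝ)) ^ α ≤ (1 / (K * u)) ^ α := by
            gcongr
            exact Nat.le_ceil _
        _ = ε / (2 * (C + 1)) := by
            rw [one_div, Real.inv_rpow hKu.le, Real.mul_rpow hK0.le (by positivity), hK, hu,
              ← Real.rpow_mul (by positivity), ← Real.rpow_mul hε.le, neg_mul,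
              one_div_mul_cancel hα.ne', Real.rpow_one, Real.rpow_neg_one]
            field_simp
    calc C * (1 / (⌈K * u⌉₊ : ℝ)) ^ α ≤ (C + 1) * (ε / (2 * (C + 1))) := by
          gcongr
          linarith
      _ = ε / 2 := by field_simp
  · have h2 : (⌈K * u⌉₊ : ℝ) + 1 ≤ (K + 2) * u := by
      have := (Nat.ceil_lt_add_one hKu.le).le
      linarith
    calc ((⌈K * u⌉₊ : ℝ) + 1) ^ n ≤ ((K + 2) * u) ^ n := by gcongr
      _ = (K + 2) ^ n * ε ^ (-((n : ℝ) / α)) := by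
          rw [mul_pow, hu, ← Real.rpow_natCast (ε ^ _), ← Real.rpow_mul hε.le]
          congr 2
          ring

/-- This lower bound lets additive constants be absorbed into multiples of the logarithm. -/
theorem half_lt_log_one_div {ε : ℝ} (hε : 0 < ε) (hε1 : ε ≤ 1 / 2) :
    1 / 2 < Real.log (1 / ε) := by
  have h1 : Real.log 2 ≤ Real.log (1 / ε) := Real.log_le_log (by norm_num) (by
    rw [le_div_iff₀ hε]; linarith)
  linarith [Real.log_two_gt_d9]

theorem exists_depth {s Q : ℝ} (hs : 0 ≤ s) :
    ∃ D : ℝ, 0 ≤ D ∧ ∀ ε : ℝ, 0 < ε → ε ≤ 1 / 2 → ∃ r : ℕ,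
      Q * ε ^ (-s) * (1 / 2) ^ r ≤ ε / 2 ∧ (r : ℝ) + 1 ≤ D * Real.log (1 / ε) := by
  obtain ⟨d, hd⟩ := pow_unbounded_of_one_lt (2 * Q) (one_lt_two (α := ℝ))
  have hl2 : 0 < Real.log 2 := Real.log_pos one_lt_two
  -- With this rate `2⁻ʳ ≤ ε ^ (s + 1 + d)`: the exponent `s` cancels the number of terms, `1`
  -- leaves a factor `ε`, and `ε ^ d ≤ 2⁻ᵈ` absorbs `2 * Q`.
  set D₀ : ℝ := (s + 1 + d) / Real.log 2 with hD₀
  refine ⟨D₀ + 4, by positivity, fun ε hε hε1 => ⟨⌈D₀ * Real.log (1 / ε)⌉₊, ?_, ?_⟩⟩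
  · have hpow : (1 / 2 : ℝ) ^ ⌈D₀ * Real.log (1 / ε)⌉₊ ≤ ε ^ (s + 1 + d) := by
      calc (1 / 2 : ℝ) ^ ⌈D₀ * Real.log (1 / ε)⌉₊
          = (1 / 2 : ℝ) ^ (⌈D₀ * Real.log (1 / ε)⌉₊ : ℝ) := (Real.rpow_natCast _ _).symm
        _ ≤ (1 / 2 : ℝ) ^ (D₀ * Real.log (1 / ε)) :=
            Real.rpow_le_rpow_of_exponent_ge (by norm_num) (by norm_num) (Nat.le_ceil _)
        _ = ε ^ (s + 1 + d) := by
            rw [Real.rpow_def_of_pos (by norm_num), Real.rpow_def_of_pos hε, one_div, one_div,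
              Real.log_inv, Real.log_inv, hD₀]
            congr 1
            field_simp
    have hεd : 2 * Q * ε ^ d ≤ 1 := by
      calc 2 * Q * ε ^ d ≤ 2 ^ d * (1 / 2) ^ d := by gcongr
        _ = 1 := by rw [← mul_pow]; norm_num
    rcases le_total Q 0 with hQ | hQ
    · refine le_trans (mul_nonpos_of_nonpos_of_nonneg
        (mul_nonpos_of_nonpos_of_nonneg hQ (by positivity)) (by positivity)) (by positivity)
    calc Q * ε ^ (-s) * (1 / 2) ^ ⌈D₀ * Real.log (1 / ε)⌉₊
        ≤ Q * ε ^ (-s) * ε ^ (s + 1 + d) := by gcongr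
      _ = Q * (ε * ε ^ d) := by
          rw [mul_assoc, ← Real.rpow_add hε, show -s + (s + 1 + d) = ((d + 1 : ℕ) : ℝ) by
            push_cast; ring, Real.rpow_natCast, pow_succ']
      _ = ε / 2 * (2 * Q * ε ^ d) := by ring
      _ ≤ ε / 2 := mul_le_of_le_one_right (by positivity) hεd
  · have hl := half_lt_log_one_div hε hε1
    have := (Nat.ceil_lt_add_one (show 0 ≤ D₀ * Real.log (1 / ε) by positivity)).le
    linarith

theorem exists_net_size {α : ℝ} (hα : 0 < α) (n C g : ℕ) :
    ∃ A : ℝ, ∀ ε : ℝ, 0 < ε → ε ≤ 1 / 2 → ∃ N r : ℕ, 0 < N ∧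
      C * (1 / (N : ℝ)) ^ α + (N + 1) ^ n * (C * (1 / 2) ^ r) ≤ ε ∧
      ((C * (r + 1) + 2 : ℕ) : ℝ) ≤ A * Real.log (1 / ε) ∧
      ((g * ((N + 1) ^ n * C) * (2 * C * (r + 1) + 1) + 1 : ℕ) : ℝ) ≤
        A * (ε ^ (-((n : ℝ) / α)) * Real.log (1 / ε)) := by
  obtain ⟨Q, hQ, hQN⟩ := exists_grid_size hα n C
  obtain ⟨D, hD, hDr⟩ := exists_depth (s := n / α) (Q := Q * C) (by positivity)
  refine ⟨(C * D + 4) + (g * (Q * C) * (2 * C * D + 2) + 2), fun ε hε hε1 => ?_⟩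
  obtain ⟨N, hN, hN1, hN2⟩ := hQN ε hε (by linarith)
  obtain ⟨r, hr1, hr2⟩ := hDr ε hε hε1
  have hl := half_lt_log_one_div hε hε1
  set ℓ := Real.log (1 / ε)
  have hv : 1 ≤ ε ^ (-((n : ℝ) / α)) := Real.one_le_rpow_of_pos_of_le_one_of_nonpos hε
    (by linarith) (neg_nonpos.2 (by positivity))
  set v := ε ^ (-((n : ℝ) / α))
  have hvl : ℓ ≤ v * ℓ := le_mul_of_one_le_left (by linarith) hv
  refine ⟨N, r, hN, ?_, ?_, ?_⟩
  · have : ((N : ℝ) + 1) ^ n * (C * (1 / 2) ^ r) ≤ ε / 2 := by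
      calc ((N : ℝ) + 1) ^ n * (C * (1 / 2) ^ r) ≤ Q * v * (C * (1 / 2) ^ r) := by gcongr
        _ = Q * C * v * (1 / 2) ^ r := by ring
        _ ≤ ε / 2 := hr1
    linarith
  · have h1 : (C : ℝ) * (r + 1) ≤ C * (D * ℓ) := by gcongr
    have h2 : 0 ≤ (g * (Q * C) * (2 * C * D + 2) + 2) * ℓ := by positivity
    push_cast
    linarith
  · have h1 : (2 * C * (r + 1) + 1 : ℝ) ≤ (2 * C * D + 2) * ℓ := by
      have : 2 * (C : ℝ) * (r + 1) ≤ 2 * C * (D * ℓ) := by gcongr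
      linarith
    have h2 : (g * ((N + 1) ^ n * C) * (2 * C * (r + 1) + 1) : ℝ) ≤
        g * (Q * v * C) * ((2 * C * D + 2) * ℓ) := by gcongr
    have h3 : 0 ≤ (C * D + 4) * (v * ℓ) := by positivity
    push_cast
    linarith

theorem mainTheorem3 (n : ℕ) (G : Subgroup (Equiv.Perm (Fin n))) (α B : ℝ)
    (hα : 0 < α) (hB : 0 < B) :
    ∃ L P : ℝ → ℕ,
      (fun ε : ℝ => (L ε : ℝ)) =O[𝓝[>] (0 : ℝ)] (fun ε : ℝ => Real.log (1 / ε)) ∧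
      (fun ε : ℝ => (P ε : ℝ)) =O[𝓝[>] (0 : ℝ)]
        (fun ε : ℝ => ε ^ (-((n : ℝ) / α)) * Real.log (1 / ε)) ∧
      ∀ ε : ℝ, 0 < ε → ∀ F ∈ holderBall n α B, IsInvariantOnCube G F →
        ∃ N ∈ invariantReLUNets G (L ε) (P ε), ∀ x ∈ unitCube n, |N.eval x 0 - F x| ≤ ε := by
  classical
  obtain ⟨C, hC⟩ := exists_invariant_net G hα hB.le
  obtain ⟨A, hA⟩ := exists_net_size hα n C (Fintype.card G)
  have hev : ∀ᶠ ε : ℝ in 𝓝[>] 0, 0 < ε ∧ ε ≤ 1 / 2 := by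
    filter_upwards [Ioc_mem_nhdsGT (show (0 : ℝ) < 1 / 2 by norm_num)] with ε hε using hε
  -- The estimates need `ε ≤ 1 / 2`; larger tolerances use the network for `1 / 2`, which does not
  -- affect the asymptotics at `0`.
  refine ⟨fun ε => ⌊A * Real.log (1 / min ε (1 / 2))⌋₊,
    fun ε => ⌊A * (min ε (1 / 2) ^ (-((n : ℝ) / α)) * Real.log (1 / min ε (1 / 2)))⌋₊,
    ?_, ?_, ?_⟩
  · refine Asymptotics.IsBigO.of_bound A ?_
    filter_upwards [hev] with ε hε
    obtain ⟨N, r, -, -, h1, -⟩ := hA ε hε.1 hε.2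
    have hl := half_lt_log_one_div hε.1 hε.2
    rw [min_eq_left hε.2, Real.norm_of_nonneg (Nat.cast_nonneg _),
      Real.norm_of_nonneg (by linarith)]
    exact Nat.floor_le ((Nat.cast_nonneg _).trans h1)
  · refine Asymptotics.IsBigO.of_bound A ?_
    filter_upwards [hev] with ε hε
    obtain ⟨N, r, -, -, -, h1⟩ := hA ε hε.1 hε.2
    have hl := half_lt_log_one_div hε.1 hε.2
    rw [min_eq_left hε.2, Real.norm_of_nonneg (Nat.cast_nonneg _),
      Real.norm_of_nonneg (mul_nonneg (Real.rpow_nonneg hε.1.le _) (by linarith))]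
    exact Nat.floor_le ((Nat.cast_nonneg _).trans h1)
  · intro ε hε F hF hFG
    obtain ⟨N, r, hN, h1, h2, h3⟩ := hA (min ε (1 / 2)) (lt_min hε (by norm_num))
      (min_le_right _ _)
    obtain ⟨R, ⟨hR1, hR2, hR3⟩, hR⟩ := hC F hF hFG N hN r
    exact ⟨R, ⟨hR1.trans (Nat.le_floor h2), hR2.trans (Nat.le_floor h3), hR3⟩,
      fun x hx => (hR x hx).trans (h1.trans (min_le_left _ _))⟩
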